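/- Let $n\ge 1$, let $A_n^+=\mathbb{C}[t_1,\dots,t_n]$, let $W_n^+=\operatorname{Der}(A_n^+)=\bigoplus_{i=1}^n A_n^+\partial_i$ with $\partial_i=\partial/\partial t_i$, and let $\tilde W_n^+=W_n^+\ltimes A_n^+$ be the Lie algebra in which $A_n^+$ is an abelian ideal and $[D,f]=D(f)$ for $D\in W_n^+$, $f\in A_n^+$. An $AW_n^+$ module is a $\tilde W_n^+$ module on which $A_n^+$ acts associatively and unitally, that is, $f(gv)=(fg)v$ and $1v=v$. It is simple if it is simple as a $\tilde W_n^+$ module. It is a weight module if it is the direct sum of its weight spaces $V_\lambda=\{v\in V: t_i\partial_i v=\lambda_i v,\ i=1,\dots,n\}$, $\lambda\in\mathbb{C}^n$, where $t_i\partial_i\in W_n^+$. Let $K_n^+=\mathbb{C}[t_1,\dots,t_n,\partial_1,\dots,\partial_n]$ be the Weyl algebra, the unital associative $\mathbb{C}$-algebra with generators $t_i,\partial_i$ and relations $t_it_j=t_jt_i$, $\partial_i\partial_j=\partial_j\partial_i$, $\partial_it_j=t_j\partial_i+\delta_{ij}$. A $K_n^+$ module is a weight module if it is the direct sum of the joint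 eigenspaces of $t_1\partial_1,\dots,t_n\partial_n$, and a module over $\mathfrak{gl}_n=\mathfrak{gl}_n(\mathbb{C})$ is a weight module if it is the direct sum of the joint eigenspaces of the matrix units $E_{11},\dots,E_{nn}$. For a $K_n^+$ module $P$ and a $\mathfrak{gl}_n$ module $M$, the tensor module $F(P,M)$ is the $AW_n^+$ module $P\otimes_{\mathbb{C}}M$ with $$f\cdot(g\otimes v)=(fg)\otimes v,\qquad (f\partial_j)\cdot(g\otimes v)=(f\partial_jg)\otimes v+\sum_{i=1}^n\big(\partial_i(f)\,g\big)\otimes(E_{ij}v)$$ for $f\in A_n^+$, $g\in P$, $v\in M$, $1\le j\le n$. **Theorem.** Let $V$ be a simple weight $AW_n^+$ module such that $V_\lambda$ is nonzero and finite-dimensional for some $\lambda\in\mathbb{C}^n$. Then there are a simple weight $K_n^+$ module $P$ and a simple weight $\mathfrak{gl}_n$ module $M$ such that $V\cong F(P,M)$ as $AW_n^+$ modules. -/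

import Mathlib

set_option linter.unusedSectionVars false

open scoped TensorProduct

universe u

-- An associative algebra is a Lie algebra through the commutator bracket.
attribute [local instance 100] LieRing.ofAssociativeRing

noncomputable section

/-! ### The Weyl algebra -/

namespace WeylAlgebra

/-- The defining relations of the Weyl algebra. The generator `Sum.inl i` stands for `t_i` and
`Sum.inr i` for `∂_i`. -/
inductive Rel (n : ℕ) :
    FreeAlgebra ℂ (Fin n ⊕ Fin n) → FreeAlgebra ℂ (Fin n ⊕ Fin n) → Prop
  | t_comm (i j : Fin n) :
      Rel n (FreeAlgebra.ι ℂ (Sum.inl i) * FreeAlgebra.ι ℂ (Sum.inl j))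
        (FreeAlgebra.ι ℂ (Sum.inl j) * FreeAlgebra.ι ℂ (Sum.inl i))
  | d_comm (i j : Fin n) :
      Rel n (FreeAlgebra.ι ℂ (Sum.inr i) * FreeAlgebra.ι ℂ (Sum.inr j))
        (FreeAlgebra.ι ℂ (Sum.inr j) * FreeAlgebra.ι ℂ (Sum.inr i))
  | d_t (i j : Fin n) :
      Rel n (FreeAlgebra.ι ℂ (Sum.inr i) * FreeAlgebra.ι ℂ (Sum.inl j))
        (FreeAlgebra.ι ℂ (Sum.inl j) * FreeAlgebra.ι ℂ (Sum.inr i) + if i = j then 1 else 0)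

end WeylAlgebra

/-- The Weyl algebra `K_n⁺ = ℂ[t_1, …, t_n, ∂_1, …, ∂_n]`: the unital associative algebra on
generators `t_i`, `∂_i` with relations `t_i t_j = t_j t_i`, `∂_i ∂_j = ∂_j ∂_i` and
`∂_i t_j = t_j ∂_i + δ_{ij}`. -/
def WeylAlgebra (n : ℕ) : Type := RingQuot (WeylAlgebra.Rel n)

namespace WeylAlgebra

variable {n : ℕ}

instance : Ring (WeylAlgebra n) := inferInstanceAs (Ring (RingQuot (WeylAlgebra.Rel n)))

instance : Algebra ℂ (WeylAlgebra n) :=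
  inferInstanceAs (Algebra ℂ (RingQuot (WeylAlgebra.Rel n)))

/-- The quotient map from the free algebra. -/
def mk (n : ℕ) : FreeAlgebra ℂ (Fin n ⊕ Fin n) →ₐ[ℂ] WeylAlgebra n :=
  RingQuot.mkAlgHom ℂ (WeylAlgebra.Rel n)

/-- The generator `t_i`. -/
def t (i : Fin n) : WeylAlgebra n := mk n (FreeAlgebra.ι ℂ (Sum.inl i))

/-- The generator `∂_i`. -/
def d (i : Fin n) : WeylAlgebra n := mk n (FreeAlgebra.ι ℂ (Sum.inr i))

theorem t_mul_t (i j : Fin n) : (t i : WeylAlgebra n) * t j = t j * t i := by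
  have h := RingQuot.mkAlgHom_rel ℂ (Rel.t_comm i j)
  rw [map_mul, map_mul] at h
  exact h

theorem d_mul_d (i j : Fin n) : (d i : WeylAlgebra n) * d j = d j * d i := by
  have h := RingQuot.mkAlgHom_rel ℂ (Rel.d_comm i j)
  rw [map_mul, map_mul] at h
  exact h

theorem d_mul_t (i j : Fin n) :
    (d i : WeylAlgebra n) * t j = t j * d i + if i = j then 1 else 0 := by
  have h := RingQuot.mkAlgHom_rel ℂ (Rel.d_t i j)
  rw [map_add, map_mul, map_mul] at h
  split_ifs at h ⊢ with hij
  · rw [map_one] at h; exact h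
  · rw [map_zero] at h; exact h

/-- The algebra homomorphism `ℂ[t_1, …, t_n] → K_n⁺` with `X_i ↦ t_i`. -/
def ofPoly (n : ℕ) : MvPolynomial (Fin n) ℂ →ₐ[ℂ] WeylAlgebra n :=
  letI : CommRing (Algebra.adjoin ℂ (Set.range (t : Fin n → WeylAlgebra n))) :=
    { (Algebra.adjoin ℂ (Set.range (t : Fin n → WeylAlgebra n))).toRing with
      mul_comm := (Algebra.isMulCommutative_adjoin ℂ (by
        rintro _ ⟨i, rfl⟩ _ ⟨j, rfl⟩
        exact t_mul_t i j)).is_comm.comm }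
  (Algebra.adjoin ℂ (Set.range (t : Fin n → WeylAlgebra n))).val.comp
    (MvPolynomial.aeval fun i => ⟨t i, Algebra.subset_adjoin ⟨i, rfl⟩⟩)

@[simp]
theorem ofPoly_X (i : Fin n) : ofPoly n (MvPolynomial.X i) = t i := by
  simp [ofPoly]

theorem d_mul_ofPoly (j : Fin n) (f : MvPolynomial (Fin n) ℂ) :
    d j * ofPoly n f = ofPoly n f * d j + ofPoly n (MvPolynomial.pderiv j f) := by
  induction f using MvPolynomial.induction_on with
  | C a =>
    rw [MvPolynomial.pderiv_C, map_zero, add_zero, ← MvPolynomial.algebraMap_eq,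
      AlgHom.commutes]
    exact (Algebra.commutes a (d j)).symm
  | add p q hp hq =>
    simp only [map_add, mul_add, add_mul, hp, hq]
    abel
  | mul_X p i hp =>
    rw [map_mul, ← mul_assoc, hp, add_mul, mul_assoc, ofPoly_X, d_mul_t, Derivation.leibniz,
      MvPolynomial.pderiv_X, smul_eq_mul, smul_eq_mul, map_add, map_mul, map_mul, ofPoly_X]
    have hc : (t i : WeylAlgebra n) * ofPoly n (MvPolynomial.pderiv j p)
        = ofPoly n (MvPolynomial.pderiv j p) * t i := by
      rw [← ofPoly_X, ← map_mul, ← map_mul, mul_comm]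
    rw [hc]
    by_cases hij : j = i
    · subst hij
      simp only [if_true, Pi.single_eq_same, map_one]
      noncomm_ring
    · rw [if_neg hij, Pi.single_eq_of_ne (fun h => hij h.symm), map_zero]
      noncomm_ring

end WeylAlgebra

/-! ### The Lie algebras `W_n⁺` and `W̃_n⁺` -/

/-- The Witt algebra `W_n⁺ = Der ℂ[t_1, …, t_n]`. -/
abbrev WittPlus (n : ℕ) : Type :=
  Derivation ℂ (MvPolynomial (Fin n) ℂ) (MvPolynomial (Fin n) ℂ)

namespace WittPlus

variable (n : ℕ)

/-- The action of `W_n⁺` on `A_n⁺`, regarded as an abelian Lie algebra, by derivations. -/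
def onPoly : WittPlus n →ₗ⁅ℂ⁆
    LieDerivation ℂ (MvPolynomial (Fin n) ℂ) (MvPolynomial (Fin n) ℂ) where
  toFun D :=
    { toLinearMap := (D : MvPolynomial (Fin n) ℂ →ₗ[ℂ] MvPolynomial (Fin n) ℂ)
      leibniz' := fun a b => by
        simp [LieRing.of_associative_ring_bracket, mul_comm] }
  map_add' _ _ := rfl
  map_smul' _ _ := rfl
  map_lie' := by
    intro D E
    ext a
    rfl

/-- The Lie algebra `W̃_n⁺ = W_n⁺ ⋉ A_n⁺`, with `A_n⁺` an abelian ideal and `[D, f] = D f` for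
`D ∈ W_n⁺` and `f ∈ A_n⁺`. -/
abbrev Ext : Type :=
  LieAlgebra.SemiDirectSum (MvPolynomial (Fin n) ℂ) (WittPlus n) (onPoly n)

variable {n}

/-- A polynomial as an element of `W̃_n⁺`. -/
def Ext.poly (f : MvPolynomial (Fin n) ℂ) : Ext n := LieAlgebra.SemiDirectSum.inl (onPoly n) f

/-- A vector field as an element of `W̃_n⁺`. -/
def Ext.field (D : WittPlus n) : Ext n := LieAlgebra.SemiDirectSum.inr (onPoly n) D

/-- The Cartan element `d_i = t_i ∂_i` of `W_n⁺`. -/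
def cartan (i : Fin n) : WittPlus n := (MvPolynomial.X i : MvPolynomial (Fin n) ℂ) •
  MvPolynomial.pderiv i

end WittPlus

/-- A `W̃_n⁺` module is an `AW_n⁺` module if `A_n⁺` acts associatively and unitally on it. -/
def IsAWModule (n : ℕ) (V : Type*) [AddCommGroup V] [LieRingModule (WittPlus.Ext n) V] : Prop :=
  (∀ (f g : MvPolynomial (Fin n) ℂ) (v : V),
    ⁅WittPlus.Ext.poly f, ⁅WittPlus.Ext.poly g, v⁆⁆ = ⁅WittPlus.Ext.poly (f * g), v⁆) ∧
  ∀ v : V, ⁅WittPlus.Ext.poly (1 : MvPolynomial (Fin n) ℂ), v⁆ = v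

/-! ### Weight modules -/

section Weight

variable {n : ℕ} {V : Type*} [AddCommGroup V] [Module ℂ V]

/-- The joint eigenspace `{v | T_i v = α_i v for all i}`. -/
def jointEigenspace (T : Fin n → Module.End ℂ V) (α : Fin n → ℂ) : Submodule ℂ V :=
  ⨅ i, (T i).eigenspace (α i)

open Classical in
/-- The operators `T_i` are simultaneously diagonalizable: `V` is the direct sum of their joint
eigenspaces. -/
def JointlyDiagonalizable (T : Fin n → Module.End ℂ V) : Prop :=
  DirectSum.IsInternal (jointEigenspace T)

end Weight

/-- The weight space `V_α` of a `W̃_n⁺` module, with respect to `d_1, …, d_n`. -/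
def WittPlus.weightSpace {n : ℕ} (V : Type*) [AddCommGroup V] [Module ℂ V]
    [LieRingModule (WittPlus.Ext n) V] [LieModule ℂ (WittPlus.Ext n) V] (α : Fin n → ℂ) :
    Submodule ℂ V :=
  jointEigenspace
    (fun i => LieModule.toEnd ℂ (WittPlus.Ext n) V (WittPlus.Ext.field (WittPlus.cartan i))) α

/-- A `W̃_n⁺` module is a weight module if the action of `d_1, …, d_n` is diagonalizable. -/
def WittPlus.IsWeightModule (n : ℕ) (V : Type*) [AddCommGroup V] [Module ℂ V]
    [LieRingModule (WittPlus.Ext n) V] [LieModule ℂ (WittPlus.Ext n) V] : Prop :=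
  JointlyDiagonalizable
    (fun i : Fin n =>
      LieModule.toEnd ℂ (WittPlus.Ext n) V (WittPlus.Ext.field (WittPlus.cartan i)))

/-- A `K_n⁺` module is a weight module if the action of `t_1 ∂_1, …, t_n ∂_n` is
diagonalizable. -/
def WeylAlgebra.IsWeightModule (n : ℕ) (P : Type*) [AddCommGroup P] [Module ℂ P]
    [Module (WeylAlgebra n) P] [IsScalarTower ℂ (WeylAlgebra n) P] : Prop :=
  JointlyDiagonalizable
    (fun i : Fin n => Algebra.lsmul ℂ ℂ P (WeylAlgebra.t i * WeylAlgebra.d i))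

/-- The Lie algebra `gl_n` of all complex `n × n` matrices. -/
abbrev GLie (n : ℕ) : Type := Matrix (Fin n) (Fin n) ℂ

/-- A `gl_n` module is a weight module if the action of `E_{11}, …, E_{nn}` is diagonalizable. -/
def GLie.IsWeightModule (n : ℕ) (M : Type*) [AddCommGroup M] [Module ℂ M]
    [LieRingModule (GLie n) M] [LieModule ℂ (GLie n) M] : Prop :=
  JointlyDiagonalizable
    (fun i : Fin n => LieModule.toEnd ℂ (GLie n) M (Matrix.single i i 1))

/-! ### Tensor modules -/

namespace TensorModule

variable (n : ℕ) (P M : Type*) [AddCommGroup P] [Module ℂ P] [Module (WeylAlgebra n) P]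
  [IsScalarTower ℂ (WeylAlgebra n) P] [AddCommGroup M] [Module ℂ M] [LieRingModule (GLie n) M]
  [LieModule ℂ (GLie n) M]

/-- The action `g ⊗ v ↦ (a g) ⊗ v` of `a ∈ K_n⁺` on `P ⊗ M`. -/
def weylAct : WeylAlgebra n →ₐ[ℂ] Module.End ℂ (P ⊗[ℂ] M) :=
  (Module.End.rTensorAlgHom ℂ P M).comp (Algebra.lsmul ℂ ℂ P)

/-- The action `g ⊗ v ↦ g ⊗ (E v)` of `E ∈ gl_n` on `P ⊗ M`. -/
def glAct : GLie n →ₗ[ℂ] Module.End ℂ (P ⊗[ℂ] M) :=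
  (Module.End.lTensorAlgHom ℂ M P).toLinearMap ∘ₗ
    (LieModule.toEnd ℂ (GLie n) M : GLie n →ₗ[ℂ] Module.End ℂ M)

variable {n P M}

@[simp]
theorem weylAct_tmul (a : WeylAlgebra n) (g : P) (v : M) :
    weylAct n P M a (g ⊗ₜ v) = (a • g) ⊗ₜ v := rfl

@[simp]
theorem glAct_tmul (E : GLie n) (g : P) (v : M) :
    glAct n P M E (g ⊗ₜ v) = g ⊗ₜ ⁅E, v⁆ := rfl

theorem weylAct_mul_glAct (a : WeylAlgebra n) (E : GLie n) :
    weylAct n P M a * glAct n P M E = glAct n P M E * weylAct n P M a := by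
  ext g v
  simp

theorem glAct_lie (E F : GLie n) :
    glAct n P M ⁅E, F⁆ = glAct n P M E * glAct n P M F - glAct n P M F * glAct n P M E := by
  ext g v
  simp [TensorProduct.tmul_sub]

theorem glAct_single (i j k l : Fin n) :
    glAct n P M (Matrix.single i j 1) * glAct n P M (Matrix.single k l 1)
      = glAct n P M (Matrix.single k l 1) * glAct n P M (Matrix.single i j 1)
        + ((if j = k then glAct n P M (Matrix.single i l 1) else 0)
          - (if l = i then glAct n P M (Matrix.single k j 1) else 0)) := by
  rw [← sub_eq_iff_eq_add', ← glAct_lie, LieRing.of_associative_ring_bracket, map_sub]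
  congr 1
  · split_ifs with h
    · subst h; simp
    · rw [Matrix.single_mul_single_of_ne _ _ _ _ h, map_zero]
  · split_ifs with h
    · subst h; simp
    · rw [Matrix.single_mul_single_of_ne _ _ _ _ h, map_zero]

variable (n P M)

/-- The action of the vector field `f ∂_j` on `P ⊗ M`:
`f ∂_j · (g ⊗ v) = (f ∂_j g) ⊗ v + ∑ i, (∂_i(f) g) ⊗ (E_{ij} v)`. -/
def monoAct (j : Fin n) : MvPolynomial (Fin n) ℂ →ₗ[ℂ] Module.End ℂ (P ⊗[ℂ] M) where
  toFun f := weylAct n P M (WeylAlgebra.ofPoly n f * WeylAlgebra.d j) +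
    ∑ i, weylAct n P M (WeylAlgebra.ofPoly n (MvPolynomial.pderiv i f)) *
      glAct n P M (Matrix.single i j 1)
  map_add' f g := by
    simp only [map_add, add_mul, Finset.sum_add_distrib]
    abel
  map_smul' c f := by
    simp only [map_smul, smul_mul_assoc, Finset.smul_sum, smul_add, RingHom.id_apply,
      Derivation.map_smul]

variable {n P M}

theorem monoAct_tmul (j : Fin n) (f : MvPolynomial (Fin n) ℂ) (g : P) (v : M) :
    monoAct n P M j f (g ⊗ₜ v) = ((WeylAlgebra.ofPoly n f * WeylAlgebra.d j) • g) ⊗ₜ[ℂ] v +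
      ∑ i, (WeylAlgebra.ofPoly n (MvPolynomial.pderiv i f) • g) ⊗ₜ[ℂ]
        ⁅(Matrix.single i j 1 : GLie n), v⁆ := by
  simp [monoAct, LinearMap.sum_apply, mul_smul]

theorem weylAct_d_mul (j : Fin n) (f : MvPolynomial (Fin n) ℂ) :
    weylAct n P M (WeylAlgebra.d j) * weylAct n P M (WeylAlgebra.ofPoly n f)
      = weylAct n P M (WeylAlgebra.ofPoly n f) * weylAct n P M (WeylAlgebra.d j)
        + weylAct n P M (WeylAlgebra.ofPoly n (MvPolynomial.pderiv j f)) := by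
  rw [← map_mul, WeylAlgebra.d_mul_ofPoly, map_add, map_mul]

theorem pderiv_comm (i j : Fin n) (f : MvPolynomial (Fin n) ℂ) :
    MvPolynomial.pderiv i (MvPolynomial.pderiv j f)
      = MvPolynomial.pderiv j (MvPolynomial.pderiv i f) := by
  have h : ⁅(MvPolynomial.pderiv i : WittPlus n), (MvPolynomial.pderiv j : WittPlus n)⁆ = 0 := by
    apply MvPolynomial.derivation_ext
    intro k
    rw [Derivation.commutator_apply]
    have hz : ∀ a b : Fin n, MvPolynomial.pderiv a
        (MvPolynomial.pderiv b (MvPolynomial.X k : MvPolynomial (Fin n) ℂ)) = 0 := by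
      intro a b
      rw [MvPolynomial.pderiv_X, Pi.single_apply]
      split_ifs <;> simp
    rw [hz, hz, sub_zero, Derivation.zero_apply]
  have h' := congrArg (fun D : WittPlus n => D f) h
  rw [Derivation.commutator_apply] at h'
  exact sub_eq_zero.mp h'

theorem monoAct_comm_poly (j : Fin n) (f g : MvPolynomial (Fin n) ℂ) :
    monoAct n P M j f * weylAct n P M (WeylAlgebra.ofPoly n g)
      - weylAct n P M (WeylAlgebra.ofPoly n g) * monoAct n P M j f
      = weylAct n P M (WeylAlgebra.ofPoly n (f * MvPolynomial.pderiv j g)) := by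
  have haa : ∀ p q : MvPolynomial (Fin n) ℂ,
      weylAct n P M (WeylAlgebra.ofPoly n p) * weylAct n P M (WeylAlgebra.ofPoly n q)
        = weylAct n P M (WeylAlgebra.ofPoly n q) * weylAct n P M (WeylAlgebra.ofPoly n p) := by
    intro p q
    rw [← map_mul, ← map_mul, mul_comm, map_mul, map_mul]
  have hsum : ∀ i : Fin n,
      weylAct n P M (WeylAlgebra.ofPoly n (MvPolynomial.pderiv i f)) *
        glAct n P M (Matrix.single i j 1) * weylAct n P M (WeylAlgebra.ofPoly n g)
      = weylAct n P M (WeylAlgebra.ofPoly n g) *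
        (weylAct n P M (WeylAlgebra.ofPoly n (MvPolynomial.pderiv i f)) *
          glAct n P M (Matrix.single i j 1)) := by
    intro i
    rw [mul_assoc, ← weylAct_mul_glAct, ← mul_assoc, haa, mul_assoc]
  have hφ : monoAct n P M j f = weylAct n P M (WeylAlgebra.ofPoly n f * WeylAlgebra.d j) +
      ∑ i, weylAct n P M (WeylAlgebra.ofPoly n (MvPolynomial.pderiv i f)) *
        glAct n P M (Matrix.single i j 1) := rfl
  rw [hφ]
  rw [add_mul, mul_add, Finset.sum_mul, Finset.mul_sum, Finset.sum_congr rfl fun i _ => hsum i]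
  rw [map_mul, mul_assoc, weylAct_d_mul, mul_add, ← mul_assoc, haa f g, map_mul, map_mul]
  noncomm_ring

theorem monoAct_comm (j k : Fin n) (f g : MvPolynomial (Fin n) ℂ) :
    monoAct n P M j f * monoAct n P M k g - monoAct n P M k g * monoAct n P M j f
      = monoAct n P M k (f * MvPolynomial.pderiv j g)
        - monoAct n P M j (g * MvPolynomial.pderiv k f) := by
  let A : MvPolynomial (Fin n) ℂ →ₐ[ℂ] Module.End ℂ (P ⊗[ℂ] M) :=
    (weylAct n P M).comp (WeylAlgebra.ofPoly n)
  let δ : Fin n → Module.End ℂ (P ⊗[ℂ] M) := fun j => weylAct n P M (WeylAlgebra.d j)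
  let e : Fin n → Fin n → Module.End ℂ (P ⊗[ℂ] M) := fun i j =>
    glAct n P M (Matrix.single i j 1)
  have hφ : ∀ j f, monoAct n P M j f
      = A f * δ j + ∑ i, A (MvPolynomial.pderiv i f) * e i j := by
    intro j f
    change weylAct n P M _ + _ = _
    rw [map_mul]
    rfl
  have hA : ∀ f g, A f * A g = A g * A f := fun f g => by rw [← map_mul, mul_comm, map_mul]
  have hδA : ∀ j f, δ j * A f = A f * δ j + A (MvPolynomial.pderiv j f) := weylAct_d_mul
  have hδδ : ∀ i j, δ i * δ j = δ j * δ i := fun i j => by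
    change weylAct n P M _ * weylAct n P M _ = weylAct n P M _ * weylAct n P M _
    rw [← map_mul, WeylAlgebra.d_mul_d, map_mul]
  have heA : ∀ i j f, e i j * A f = A f * e i j := fun i j f => (weylAct_mul_glAct _ _).symm
  have heδ : ∀ i j k, e i j * δ k = δ k * e i j := fun i j k => (weylAct_mul_glAct _ _).symm
  have hee : ∀ i j k l, e i j * e k l = e k l * e i j
      + ((if j = k then e i l else 0) - (if l = i then e k j else 0)) := glAct_single
  have h1 : ∀ (j k : Fin n) (f g), A f * δ j * (A g * δ k) - A g * δ k * (A f * δ j)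
      = A (f * MvPolynomial.pderiv j g) * δ k - A (g * MvPolynomial.pderiv k f) * δ j := by
    intro j k f g
    have e1 : A f * δ j * (A g * δ k) = A f * A g * (δ j * δ k)
        + A f * A (MvPolynomial.pderiv j g) * δ k := by
      rw [mul_assoc, ← mul_assoc (δ j), hδA]; noncomm_ring
    have e2 : A g * δ k * (A f * δ j) = A f * A g * (δ j * δ k)
        + A g * A (MvPolynomial.pderiv k f) * δ j := by
      rw [mul_assoc, ← mul_assoc (δ k), hδA, hA f g, hδδ j k]; noncomm_ring
    rw [e1, e2, map_mul, map_mul]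
    abel
  have h2 : ∀ (j k : Fin n) (f g),
      A f * δ j * (∑ l, A (MvPolynomial.pderiv l g) * e l k)
        - (∑ l, A (MvPolynomial.pderiv l g) * e l k) * (A f * δ j)
      = ∑ l, A (f * MvPolynomial.pderiv l (MvPolynomial.pderiv j g)) * e l k := by
    intro j k f g
    rw [Finset.mul_sum, Finset.sum_mul, ← Finset.sum_sub_distrib]
    refine Finset.sum_congr rfl fun l _ => ?_
    have e1 : A f * δ j * (A (MvPolynomial.pderiv l g) * e l k)
        = A f * A (MvPolynomial.pderiv l g) * (δ j * e l k)
          + A f * A (MvPolynomial.pderiv j (MvPolynomial.pderiv l g)) * e l k := by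
      rw [mul_assoc, ← mul_assoc (δ j), hδA]; noncomm_ring
    have e2 : A (MvPolynomial.pderiv l g) * e l k * (A f * δ j)
        = A f * A (MvPolynomial.pderiv l g) * (δ j * e l k) := by
      rw [mul_assoc, ← mul_assoc (e l k), heA, mul_assoc (A f), heδ, ← mul_assoc,
        hA _ f]
    rw [e1, e2, map_mul, pderiv_comm]
    abel
  have h3 : (∑ i, A (MvPolynomial.pderiv i f) * e i j)
        * (∑ l, A (MvPolynomial.pderiv l g) * e l k)
      - (∑ l, A (MvPolynomial.pderiv l g) * e l k)
        * (∑ i, A (MvPolynomial.pderiv i f) * e i j)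
      = ∑ i, A (MvPolynomial.pderiv i f * MvPolynomial.pderiv j g) * e i k
        - ∑ l, A (MvPolynomial.pderiv l g * MvPolynomial.pderiv k f) * e l j := by
    have e1 : ∀ i l, A (MvPolynomial.pderiv i f) * e i j * (A (MvPolynomial.pderiv l g) * e l k)
        = A (MvPolynomial.pderiv l g) * e l k * (A (MvPolynomial.pderiv i f) * e i j)
          + ((if j = l then A (MvPolynomial.pderiv i f * MvPolynomial.pderiv l g) * e i k else 0)
            - (if k = i then A (MvPolynomial.pderiv l g * MvPolynomial.pderiv i f) * e l j
                else 0)) := by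
      intro i l
      have e2 : A (MvPolynomial.pderiv i f) * e i j * (A (MvPolynomial.pderiv l g) * e l k)
          = A (MvPolynomial.pderiv i f) * A (MvPolynomial.pderiv l g) * (e i j * e l k) := by
        rw [mul_assoc, ← mul_assoc (e i j), heA]; noncomm_ring
      have e3 : A (MvPolynomial.pderiv l g) * e l k * (A (MvPolynomial.pderiv i f) * e i j)
          = A (MvPolynomial.pderiv i f) * A (MvPolynomial.pderiv l g) * (e l k * e i j) := by
        rw [mul_assoc, ← mul_assoc (e l k), heA, hA (MvPolynomial.pderiv i f)]; noncomm_ring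
      rw [e2, e3, hee, mul_add, mul_sub, mul_ite, mul_ite, mul_zero, map_mul, map_mul,
        hA (MvPolynomial.pderiv l g)]
    rw [Finset.sum_mul_sum, Finset.sum_mul_sum, Finset.sum_comm (s := Finset.univ)
      (f := fun l i => A (MvPolynomial.pderiv l g) * e l k * (A (MvPolynomial.pderiv i f) * e i j))]
    simp only [e1, Finset.sum_add_distrib, Finset.sum_sub_distrib]
    rw [add_sub_cancel_left]
    congr 1
    · exact Finset.sum_congr rfl fun i _ => by rw [Finset.sum_ite_eq, if_pos (Finset.mem_univ _)]
    · rw [Finset.sum_comm]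
      exact Finset.sum_congr rfl fun i _ => by rw [Finset.sum_ite_eq, if_pos (Finset.mem_univ _)]
  have h4 : ∀ (j k : Fin n) (f g : MvPolynomial (Fin n) ℂ),
      ∑ i, A (MvPolynomial.pderiv i (f * MvPolynomial.pderiv j g)) * e i k
      = ∑ i, A (f * MvPolynomial.pderiv i (MvPolynomial.pderiv j g)) * e i k
        + ∑ i, A (MvPolynomial.pderiv i f * MvPolynomial.pderiv j g) * e i k := by
    intro j k f g
    rw [← Finset.sum_add_distrib]
    refine Finset.sum_congr rfl fun i _ => ?_
    rw [Derivation.leibniz, smul_eq_mul, smul_eq_mul, map_add, add_mul,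
      mul_comm (MvPolynomial.pderiv j g)]
  have h1' := h1 j k f g
  have h2' := h2 j k f g
  have h2'' := h2 k j g f
  simp only [hφ, h4]
  rw [sub_eq_iff_eq_add] at h1' h2' h2'' h3
  simp only [add_mul, mul_add]
  rw [h1', h2', h2'', h3]
  abel

theorem derivation_sum_apply (E : Fin n → WittPlus n) (f : MvPolynomial (Fin n) ℂ) :
    (∑ j, E j) f = ∑ j, E j f := by
  have h : (∑ j, E j).toLinearMap = ∑ j, (E j).toLinearMap :=
    map_sum (⟨⟨fun D : WittPlus n => D.toLinearMap, rfl⟩, fun _ _ => rfl⟩ :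
      WittPlus n →+ (MvPolynomial (Fin n) ℂ →ₗ[ℂ] MvPolynomial (Fin n) ℂ)) E Finset.univ
  have h' := congrArg (fun L => L f) h
  simp only [LinearMap.sum_apply] at h'
  exact h'

theorem derivation_eq_sum (D : WittPlus n) (f : MvPolynomial (Fin n) ℂ) :
    D f = ∑ j, D (MvPolynomial.X j) * MvPolynomial.pderiv j f := by
  have h : D = ∑ j, D (MvPolynomial.X j) • (MvPolynomial.pderiv j : WittPlus n) := by
    apply MvPolynomial.derivation_ext
    intro k
    rw [derivation_sum_apply]
    simp [MvPolynomial.pderiv_X, Pi.single_apply]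
  conv_lhs => rw [h]
  rw [derivation_sum_apply]
  rfl

variable (n P M)

/-- The action of `W̃_n⁺` on `P ⊗ M`: a polynomial acts through `P` and the vector field
`D = ∑ j, f_j ∂_j`, where `f_j = D t_j`, acts as the sum of the actions of the `f_j ∂_j`. -/
def act : WittPlus.Ext n →ₗ⁅ℂ⁆ Module.End ℂ (P ⊗[ℂ] M) where
  toFun x := weylAct n P M (WeylAlgebra.ofPoly n x.left) +
    ∑ j, monoAct n P M j (x.right (MvPolynomial.X j))
  map_add' x y := by
    simp [Finset.sum_add_distrib]
    abel
  map_smul' c x := by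
    simp [Finset.smul_sum]
  map_lie' := by
    intro x y
    have h1 : ∀ (D : WittPlus n) (g : MvPolynomial (Fin n) ℂ),
        (∑ j, monoAct n P M j (D (MvPolynomial.X j))) * weylAct n P M (WeylAlgebra.ofPoly n g)
        = weylAct n P M (WeylAlgebra.ofPoly n g) * (∑ j, monoAct n P M j (D (MvPolynomial.X j)))
          + weylAct n P M (WeylAlgebra.ofPoly n (D g)) := by
      intro D g
      rw [← sub_eq_iff_eq_add', Finset.sum_mul, Finset.mul_sum, ← Finset.sum_sub_distrib,
        derivation_eq_sum D g, map_sum, map_sum]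
      exact Finset.sum_congr rfl fun j _ => monoAct_comm_poly j _ g
    have h2 : ∀ D E : WittPlus n,
        (∑ j, monoAct n P M j (⁅D, E⁆ (MvPolynomial.X j)))
        = (∑ j, monoAct n P M j (D (MvPolynomial.X j)))
            * (∑ j, monoAct n P M j (E (MvPolynomial.X j)))
          - (∑ j, monoAct n P M j (E (MvPolynomial.X j)))
            * (∑ j, monoAct n P M j (D (MvPolynomial.X j))) := by
      intro D E
      rw [Finset.sum_mul_sum, Finset.sum_mul_sum, Finset.sum_comm (s := Finset.univ)
        (f := fun i j => monoAct n P M i (E (MvPolynomial.X i))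
          * monoAct n P M j (D (MvPolynomial.X j))), ← Finset.sum_sub_distrib]
      simp only [← Finset.sum_sub_distrib, monoAct_comm]
      simp only [Finset.sum_sub_distrib]
      rw [Finset.sum_comm]
      simp only [← map_sum, ← derivation_eq_sum, Derivation.commutator_apply, map_sub,
        Finset.sum_sub_distrib]
    have h3 : weylAct n P M (WeylAlgebra.ofPoly n x.left)
          * weylAct n P M (WeylAlgebra.ofPoly n y.left)
        = weylAct n P M (WeylAlgebra.ofPoly n y.left)
          * weylAct n P M (WeylAlgebra.ofPoly n x.left) := by
      rw [← map_mul, ← map_mul, mul_comm, map_mul, map_mul]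
    have h4 : ⁅x, y⁆.left = x.right y.left - y.right x.left := by
      change ⁅x.left, y.left⁆ + x.right y.left - y.right x.left = _
      rw [LieRing.of_associative_ring_bracket, mul_comm, sub_self, zero_add]
    have h5 : ⁅x, y⁆.right = ⁅x.right, y.right⁆ := rfl
    rw [h4, h5, h2, LieRing.of_associative_ring_bracket]
    simp only [add_mul, mul_add, h1, map_sub]
    rw [h3]
    abel

end TensorModule

/-- The tensor module `F(P, M) = P ⊗ M`. -/
def TensorModule (_n : ℕ) (P M : Type*) [AddCommGroup P] [Module ℂ P] [AddCommGroup M]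
    [Module ℂ M] : Type _ := P ⊗[ℂ] M

namespace TensorModule

variable {n : ℕ} {P M : Type*} [AddCommGroup P] [Module ℂ P] [AddCommGroup M] [Module ℂ M]

instance : AddCommGroup (TensorModule n P M) := inferInstanceAs (AddCommGroup (P ⊗[ℂ] M))

instance : Module ℂ (TensorModule n P M) := inferInstanceAs (Module ℂ (P ⊗[ℂ] M))

variable [Module (WeylAlgebra n) P] [IsScalarTower ℂ (WeylAlgebra n) P]
  [LieRingModule (GLie n) M] [LieModule ℂ (GLie n) M]

instance : LieRingModule (WittPlus.Ext n) (TensorModule n P M) where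
  bracket x w := act n P M x w
  add_lie x y w := by
    change act n P M (x + y) w = act n P M x w + act n P M y w
    rw [map_add]; rfl
  lie_add x w w' := map_add (act n P M x) w w'
  leibniz_lie x y w := by
    change act n P M x (act n P M y w) = act n P M ⁅x, y⁆ w + act n P M y (act n P M x w)
    rw [LieHom.map_lie]
    exact (sub_add_cancel _ _).symm

instance : LieModule ℂ (WittPlus.Ext n) (TensorModule n P M) where
  smul_lie c x w := by
    change act n P M (c • x) w = c • act n P M x w
    rw [map_smul]; rfl
  lie_smul c x w := map_smul (act n P M x) c w

end TensorModule

end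

/-!
Let `A` and `Φ` denote the actions on `V` of polynomials and of vector fields. Polynomials and the
vector fields `∂_j` generate an action of the Weyl algebra `K = K_n⁺` on `V`, and the operators
`E_{ij} = t_i ∂_j - t_i · ∂_j` (the action of the vector field minus the composite of two actions)
commute with it and satisfy the relations of the matrix units of `gl_n`
(`IsFieldAction.matrixUnit_mul_matrixUnit`).

The finite-dimensional weight space contains a joint eigenvector `v` of all `t_i · ∂_i`, hence of
all `E_{ii}`. This is the only place where finiteness enters. The operator `E = ∑ i, E_{ii}`
commutes with `K`, and with respect to `E` a vector field with coefficients of degree `d ≥ 1` has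
components in degrees `0, …, d - 1` only. So the vectors of degree at least `m` above that of `v`
form a submodule, and simplicity forces `E` to be a scalar (`sum_matrixUnit_apply_eq_smul`). Once
`E` is a scalar, Euler's identity turns its vanishing commutator with `g ∂_j` into a recursion on
the degree of `g`, whose solution is the formula
`g ∂_j = g · ∂_j + ∑ i, ∂_i(g) · E_{ij}` of a tensor module (`IsFieldAction.field_eq_of_commute`).

It remains to split `V`, now simple under the commuting actions of `K` and `gl_n`. For each `i`, the
vectors on which `t_i` (or `∂_i`) is nilpotent form a submodule, so `t_i` and `∂_i` are injective or
locally nilpotent on `V`. Hence all nonzero passages between weight spaces are reversible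
(`isRegular_of_simple`), so that `P = K v` is simple and has one-dimensional weight spaces, spanned
by monomials `t^p ∂^q v` with disjoint exponents. With `M = Hom_K(P, V)`, evaluation
`P ⊗ M → V` is injective because distinct weights are independent, and surjective because its image
is a submodule; the same two facts give the simplicity of `M`.
-/

/-! ### Operators attached to polynomials and vector fields -/

namespace WittPlus

open MvPolynomial

variable {n : ℕ} {R : Type*} [Ring R] [Algebra ℂ R]

/-- A pair of maps into an associative algebra, `A f` standing for the action of the polynomial `f`
and `Φ j f` for that of the vector field `f ∂_j`, that satisfies the commutation relations of
`W̃_n⁺`. Associativity and unitality of the action of polynomials are built into `A`. -/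
structure IsFieldAction (A : MvPolynomial (Fin n) ℂ →ₐ[ℂ] R)
    (Φ : Fin n → MvPolynomial (Fin n) ℂ →ₗ[ℂ] R) : Prop where
  comm_poly : ∀ j f g, Φ j f * A g - A g * Φ j f = A (f * pderiv j g)
  comm_field : ∀ j k f g, Φ j f * Φ k g - Φ k g * Φ j f
    = Φ k (f * pderiv j g) - Φ j (g * pderiv k f)

/-- The operator `t_i ∂_j - t_i · ∂_j`, the difference between the action of the vector field
`t_i ∂_j` and the composite of the actions of `∂_j` and `t_i`. These operators play the role of
the matrix units of `gl_n`. -/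
noncomputable def matrixUnit (A : MvPolynomial (Fin n) ℂ →ₐ[ℂ] R)
    (Φ : Fin n → MvPolynomial (Fin n) ℂ →ₗ[ℂ] R) (i j : Fin n) : R :=
  Φ j (X i) - A (X i) * Φ j 1

namespace IsFieldAction

variable {A : MvPolynomial (Fin n) ℂ →ₐ[ℂ] R} {Φ : Fin n → MvPolynomial (Fin n) ℂ →ₗ[ℂ] R}


theorem comm_poly' (h : IsFieldAction A Φ) (j : Fin n) (f g : MvPolynomial (Fin n) ℂ) :
    Φ j f * A g = A g * Φ j f + A (f * pderiv j g) :=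
  sub_eq_iff_eq_add'.mp (h.comm_poly j f g)

theorem matrixUnit_comm_poly (h : IsFieldAction A Φ) (i j : Fin n) (g : MvPolynomial (Fin n) ℂ) :
    Commute (matrixUnit A Φ i j) (A g) := by
  change matrixUnit A Φ i j * A g = A g * matrixUnit A Φ i j
  have h1 : A g * A (X i) = A (X i) * A g := by rw [← map_mul, mul_comm, map_mul]
  rw [matrixUnit, sub_mul, mul_sub, mul_assoc, h.comm_poly', h.comm_poly', one_mul, map_mul,
    ← mul_assoc (A g), h1]
  noncomm_ring

theorem matrixUnit_mul_field (h : IsFieldAction A Φ) (i j k : Fin n) (g : MvPolynomial (Fin n) ℂ) :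
    matrixUnit A Φ i j * Φ k g - Φ k g * matrixUnit A Φ i j
      = Φ k (X i * pderiv j g) - Φ j (g * pderiv k (X i)) - A (X i) * Φ k (pderiv j g)
        + A (g * pderiv k (X i)) * Φ j 1 := by
  have h1 := h.comm_field j k (X i) g
  have h2 := h.comm_field j k 1 g
  rw [one_mul, (pderiv k).map_one_eq_zero, mul_zero, map_zero, sub_zero] at h2
  have h3 := h.comm_poly' k g (X i)
  rw [matrixUnit, ← h1, ← h2]
  have h4 : Φ k g * (A (X i) * Φ j 1) = (A (X i) * Φ k g + A (g * pderiv k (X i))) * Φ j 1 := by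
    rw [← mul_assoc, h3]
  rw [mul_sub, h4]
  noncomm_ring

theorem matrixUnit_comm_d (h : IsFieldAction A Φ) (i j k : Fin n) :
    Commute (matrixUnit A Φ i j) (Φ k 1) := by
  have h1 := h.matrixUnit_mul_field i j k 1
  rw [(pderiv j).map_one_eq_zero, mul_zero, map_zero, mul_zero, one_mul, pderiv_X,
    Pi.single_apply] at h1
  refine sub_eq_zero.mp (h1.trans ?_)
  split_ifs <;> simp

theorem matrixUnit_mul_matrixUnit (h : IsFieldAction A Φ) (i j k l : Fin n) :
    matrixUnit A Φ i j * matrixUnit A Φ k l - matrixUnit A Φ k l * matrixUnit A Φ i j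
      = (if j = k then matrixUnit A Φ i l else 0) - (if l = i then matrixUnit A Φ k j else 0) := by
  have h1 := h.matrixUnit_mul_field i j l (X k)
  have h2 : matrixUnit A Φ i j * (A (X k) * Φ l 1) = A (X k) * Φ l 1 * matrixUnit A Φ i j :=
    ((h.matrixUnit_comm_poly i j (X k)).mul_right (h.matrixUnit_comm_d i j l)).eq
  have h3 : matrixUnit A Φ k l = Φ l (X k) - A (X k) * Φ l 1 := rfl
  rw [h3, mul_sub, sub_mul, h2, sub_sub_sub_cancel_right, h1, pderiv_X, pderiv_X,
    Pi.single_apply, Pi.single_apply]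
  by_cases hjk : k = j <;> by_cases hil : i = l
  · subst hjk hil; simp [matrixUnit]; abel
  · subst hjk; simp [matrixUnit, hil, Ne.symm hil]
  · subst hil; simp [matrixUnit, hjk, Ne.symm hjk]; abel
  · simp [hjk, hil, Ne.symm hjk, Ne.symm hil]

/-- The commutator of `∑ i, t_i ∂_i - t_i · ∂_i` with a vector field. If the coefficient `g` is
homogeneous of degree `d`, the first two terms add up to `(d - 1) g ∂_j`. -/
theorem sum_matrixUnit_mul_field (h : IsFieldAction A Φ) (j : Fin n) (g : MvPolynomial (Fin n) ℂ) :
    (∑ i, matrixUnit A Φ i i) * Φ j g - Φ j g * ∑ i, matrixUnit A Φ i i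
      = Φ j (∑ i, X i * pderiv i g) - Φ j g - ∑ i, A (X i) * Φ j (pderiv i g)
        + A g * Φ j 1 := by
  rw [Finset.sum_mul, Finset.mul_sum, ← Finset.sum_sub_distrib]
  simp only [h.matrixUnit_mul_field, pderiv_X, Pi.single_apply, mul_ite, mul_one, mul_zero]
  rw [Finset.sum_add_distrib, Finset.sum_sub_distrib, Finset.sum_sub_distrib, map_sum]
  congr 1
  · congr 2
    rw [Finset.sum_eq_single j] <;> simp +contextual
  · rw [Finset.sum_eq_single j] <;> simp +contextual

theorem sum_matrixUnit_comm_poly (h : IsFieldAction A Φ) (g : MvPolynomial (Fin n) ℂ) :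
    Commute (∑ i, matrixUnit A Φ i i) (A g) :=
  Commute.sum_left _ _ _ fun i _ => h.matrixUnit_comm_poly i i g

theorem sum_matrixUnit_comm_d (h : IsFieldAction A Φ) (j : Fin n) :
    Commute (∑ i, matrixUnit A Φ i i) (Φ j 1) :=
  Commute.sum_left _ _ _ fun i _ => h.matrixUnit_comm_d i i j

theorem sum_matrixUnit_comm_C (h : IsFieldAction A Φ) (j : Fin n) (a : ℂ) :
    Commute (∑ i, matrixUnit A Φ i i) (Φ j (C a)) := by
  have : (C a : MvPolynomial (Fin n) ℂ) = a • 1 := by rw [smul_eq_C_mul, mul_one]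
  rw [this, map_smul]
  exact (h.sum_matrixUnit_comm_d j).smul_right a

/-- The operator `∑ i, t_i ∂_i - t_i · ∂_i` has degree `d` with respect to itself on vector fields
with homogeneous coefficients of degree `d + 1`, up to vector fields of lower degree. -/
theorem sum_matrixUnit_mul_field_of_isHomogeneous (h : IsFieldAction A Φ) (j : Fin n)
    {g : MvPolynomial (Fin n) ℂ} {d : ℕ} (hg : g.IsHomogeneous (d + 1)) :
    (∑ i, matrixUnit A Φ i i) * Φ j g - Φ j g * ∑ i, matrixUnit A Φ i i
      = (d : ℂ) • Φ j g - ∑ i, A (X i) * Φ j (pderiv i g) + A g * Φ j 1 := by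
  rw [h.sum_matrixUnit_mul_field, hg.sum_X_mul_pderiv, map_nsmul, succ_nsmul, add_sub_cancel_right,
    Nat.cast_smul_eq_nsmul]

/-- Euler's identity for a vector field whose coefficients are linear. -/
theorem sum_poly_mul_field_pderiv_of_isHomogeneous_one (j : Fin n) {g : MvPolynomial (Fin n) ℂ}
    (hg : g.IsHomogeneous 1) : ∑ i, A (X i) * Φ j (pderiv i g) = A g * Φ j 1 := by
  have h1 : ∀ i, A (X i) * Φ j (pderiv i g) = A (X i * pderiv i g) * Φ j 1 := by
    intro i
    have h2 : (pderiv i g).IsHomogeneous 0 := hg.pderiv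
    obtain ⟨a, ha⟩ : ∃ a, pderiv i g = a • 1 :=
      ⟨_, (totalDegree_eq_zero_iff_eq_C.mp (h2.totalDegree_le.antisymm (Nat.zero_le _))).trans
        (by rw [smul_eq_C_mul, mul_one])⟩
    rw [ha, map_smul, mul_smul_comm, mul_smul_comm, mul_one, map_smul, smul_mul_assoc]
  rw [Finset.sum_congr rfl fun i _ => h1 i, ← Finset.sum_mul, ← map_sum, hg.sum_X_mul_pderiv,
    one_nsmul]

/-- If the central element of `gl_n` acts by an operator that commutes with all vector fields,
then a vector field acts as on a tensor module: only its coefficients and their first order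
derivatives enter. -/
theorem field_eq_of_commute (h : IsFieldAction A Φ)
    (hE : ∀ j g, Commute (∑ i, matrixUnit A Φ i i) (Φ j g)) (j : Fin n)
    (g : MvPolynomial (Fin n) ℂ) :
    Φ j g = A g * Φ j 1 + ∑ i, A (pderiv i g) * matrixUnit A Φ i j := by
  have key : ∀ (d : ℕ) (g : MvPolynomial (Fin n) ℂ), g.IsHomogeneous d →
      Φ j g = A g * Φ j 1 + ∑ i, A (pderiv i g) * matrixUnit A Φ i j := by
    intro d
    induction d with
    | zero =>
      intro g hg
      obtain ⟨a, rfl⟩ : ∃ a, g = C a :=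
        ⟨_, totalDegree_eq_zero_iff_eq_C.mp (hg.totalDegree_le.antisymm (Nat.zero_le _))⟩
      have : (C a : MvPolynomial (Fin n) ℂ) = a • 1 := by rw [smul_eq_C_mul, mul_one]
      simp [this]
    | succ d ih =>
      intro g hg
      rcases Nat.eq_zero_or_pos d with rfl | hd
      · have h1 : ∀ i, ∃ a : ℂ, pderiv i g = a • 1 := fun i =>
          ⟨_, (totalDegree_eq_zero_iff_eq_C.mp
            ((hg.pderiv : (pderiv i g).IsHomogeneous 0).totalDegree_le.antisymm
              (Nat.zero_le _))).trans (by rw [smul_eq_C_mul, mul_one])⟩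
        choose a ha using h1
        have h2 : g = ∑ i, a i • X i := by
          have h3 := hg.sum_X_mul_pderiv
          rw [zero_add, one_nsmul] at h3
          rw [← h3]
          simp only [ha, mul_smul_comm, mul_one]
        simp only [ha]
        rw [h2]
        simp only [map_sum, map_smul, map_one, smul_mul_assoc, one_mul, matrixUnit, smul_sub,
          Finset.sum_sub_distrib, Finset.sum_mul]
        abel
      · have h1 := h.sum_matrixUnit_mul_field_of_isHomogeneous j hg
        rw [(hE j g).eq, sub_self] at h1
        have h2 : ∀ i, (pderiv i g).IsHomogeneous d := fun i => hg.pderiv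
        have h3 : ∑ i, A (X i) * Φ j (pderiv i g)
            = ((d : ℂ) + 1) • (A g * Φ j 1)
              + (d : ℂ) • ∑ k, A (pderiv k g) * matrixUnit A Φ k j := by
          have h4 : ∀ i, A (X i) * Φ j (pderiv i g) = A (X i * pderiv i g) * Φ j 1
              + ∑ k, A (X i * pderiv i (pderiv k g)) * matrixUnit A Φ k j := by
            intro i
            rw [ih _ (h2 i), mul_add, Finset.mul_sum, map_mul, mul_assoc]
            congr 1
            refine Finset.sum_congr rfl fun k _ => ?_
            rw [TensorModule.pderiv_comm, map_mul, mul_assoc]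
          rw [Finset.sum_congr rfl fun i _ => h4 i, Finset.sum_add_distrib, Finset.sum_comm,
            ← Finset.sum_mul, ← map_sum, hg.sum_X_mul_pderiv, Finset.smul_sum]
          congr 1
          · rw [map_nsmul, smul_mul_assoc, ← Nat.cast_smul_eq_nsmul ℂ, Nat.cast_succ]
          · refine Finset.sum_congr rfl fun k _ => ?_
            rw [← Finset.sum_mul, ← map_sum, (h2 k).sum_X_mul_pderiv, map_nsmul, smul_mul_assoc,
              ← Nat.cast_smul_eq_nsmul ℂ]
        have hd' : (d : ℂ) ≠ 0 := Nat.cast_ne_zero.mpr hd.ne'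
        rw [h3] at h1
        refine smul_right_injective R hd' ?_
        change (d : ℂ) • Φ j g = (d : ℂ) • (A g * Φ j 1 + _)
        rw [smul_add, ← sub_eq_zero, h1, add_smul, one_smul]
        abel
  induction g using MvPolynomial.induction_on' with
  | monomial u a => exact key _ _ (isHomogeneous_monomial a rfl)
  | add p q hp hq =>
    rw [map_add, hp, hq]
    simp only [map_add, add_mul, Finset.sum_add_distrib]
    abel

end IsFieldAction

end WittPlus

/-! ### The operators on an `AW_n⁺` module -/

namespace WittPlus

open MvPolynomial

section Action

variable {n : ℕ} {V : Type*} [AddCommGroup V] [Module ℂ V] [LieRingModule (Ext n) V]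
  [LieModule ℂ (Ext n) V]

theorem Ext.lie_field_poly (D : WittPlus n) (f : MvPolynomial (Fin n) ℂ) :
    ⁅Ext.field D, Ext.poly f⁆ = Ext.poly (D f) := by
  refine LieAlgebra.SemiDirectSum.ext ?_ ?_
  · change ⁅(0 : MvPolynomial (Fin n) ℂ), f⁆ + D f - (0 : WittPlus n) 0 = D f
    rw [zero_lie, zero_add, map_zero, sub_zero]
  · exact lie_zero D

theorem Ext.eq_poly_add_sum (x : Ext n) :
    x = Ext.poly x.left + ∑ j, Ext.field (x.right (X j) • (pderiv j : WittPlus n)) := by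
  have h1 : x.right = ∑ j, x.right (X j) • (pderiv j : WittPlus n) := by
    ext1 k
    rw [TensorModule.derivation_sum_apply]
    simp [pderiv_X, Pi.single_apply]
  have h2 : x = Ext.poly x.left + Ext.field x.right := by
    refine LieAlgebra.SemiDirectSum.ext ?_ ?_
    · change x.left = x.left + 0
      simp
    · change x.right = 0 + x.right
      simp
  have h3 : Ext.field x.right = ∑ j, Ext.field (x.right (X j) • (pderiv j : WittPlus n)) := by
    conv_lhs => rw [h1]
    exact map_sum (LieAlgebra.SemiDirectSum.inr (onPoly n)) _ _
  rw [← h3, ← h2]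

theorem lie_smul_pderiv (j k : Fin n) (f g : MvPolynomial (Fin n) ℂ) :
    ⁅f • (pderiv j : WittPlus n), g • (pderiv k : WittPlus n)⁆
      = (f * pderiv j g) • (pderiv k : WittPlus n)
        - (g * pderiv k f) • (pderiv j : WittPlus n) := by
  ext1 l
  rw [Derivation.commutator_apply]
  simp only [Derivation.smul_apply, Derivation.sub_apply, smul_eq_mul, Derivation.leibniz, pderiv_X,
    Pi.single_apply]
  split_ifs <;> simp

/-- The action of polynomials on an `AW_n⁺` module as a homomorphism of associative algebras. -/
noncomputable def polyAct (hAW : IsAWModule n V) :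
    MvPolynomial (Fin n) ℂ →ₐ[ℂ] Module.End ℂ V :=
  AlgHom.ofLinearMap
    ((LieModule.toEnd ℂ (Ext n) V : Ext n →ₗ[ℂ] Module.End ℂ V) ∘ₗ
      (LieAlgebra.SemiDirectSum.inl (onPoly n) : MvPolynomial (Fin n) ℂ →ₗ[ℂ] Ext n))
    (LinearMap.ext hAW.2) (fun f g => LinearMap.ext fun v => (hAW.1 f g v).symm)

variable (V) in
/-- The action of the vector fields `f ∂_j` as a linear function of `f`. -/
noncomputable def fieldAct (j : Fin n) : MvPolynomial (Fin n) ℂ →ₗ[ℂ] Module.End ℂ V :=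
  (LieModule.toEnd ℂ (Ext n) V : Ext n →ₗ[ℂ] Module.End ℂ V) ∘ₗ
    (LieAlgebra.SemiDirectSum.inr (onPoly n) : WittPlus n →ₗ[ℂ] Ext n) ∘ₗ
    (LinearMap.toSpanSingleton (MvPolynomial (Fin n) ℂ) (WittPlus n) (pderiv j)).restrictScalars ℂ

theorem polyAct_apply (hAW : IsAWModule n V) (f : MvPolynomial (Fin n) ℂ) (v : V) :
    polyAct hAW f v = ⁅Ext.poly f, v⁆ := rfl

theorem fieldAct_apply (j : Fin n) (f : MvPolynomial (Fin n) ℂ) (v : V) :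
    fieldAct V j f v = ⁅Ext.field (f • (pderiv j : WittPlus n)), v⁆ := rfl

theorem isFieldAction (hAW : IsAWModule n V) : IsFieldAction (polyAct hAW) (fieldAct V) where
  comm_poly j f g := by
    ext v
    change ⁅Ext.field (f • (pderiv j : WittPlus n)), ⁅Ext.poly g, v⁆⁆
        - ⁅Ext.poly g, ⁅Ext.field (f • (pderiv j : WittPlus n)), v⁆⁆
      = ⁅Ext.poly (f * pderiv j g), v⁆
    rw [← lie_lie, Ext.lie_field_poly (f • (pderiv j : WittPlus n)) g]
    rfl
  comm_field j k f g := by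
    ext v
    change ⁅Ext.field (f • (pderiv j : WittPlus n)), ⁅Ext.field (g • (pderiv k : WittPlus n)), v⁆⁆
        - ⁅Ext.field (g • (pderiv k : WittPlus n)), ⁅Ext.field (f • (pderiv j : WittPlus n)), v⁆⁆
      = ⁅Ext.field ((f * pderiv j g) • (pderiv k : WittPlus n)), v⁆
        - ⁅Ext.field ((g * pderiv k f) • (pderiv j : WittPlus n)), v⁆
    have h1 : ⁅Ext.field (f • (pderiv j : WittPlus n)), Ext.field (g • (pderiv k : WittPlus n))⁆
        = Ext.field ((f * pderiv j g) • (pderiv k : WittPlus n))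
          - Ext.field ((g * pderiv k f) • (pderiv j : WittPlus n)) :=
      ((LieAlgebra.SemiDirectSum.inr (onPoly n)).map_lie _ _).symm.trans <| by
        rw [lie_smul_pderiv, map_sub]; rfl
    rw [← lie_lie, h1, sub_lie]

/-- In a simple module a subspace that is stable under all polynomials and all vector fields
`f ∂_j` is trivial. -/
theorem eq_bot_or_eq_top_of_stable (hAW : IsAWModule n V)
    (hsimple : LieModule.IsIrreducible ℂ (Ext n) V) (U : Submodule ℂ V)
    (hA : ∀ f, ∀ w ∈ U, polyAct hAW f w ∈ U) 
    (hΦ : ∀ (j : Fin n) f, ∀ w ∈ U, fieldAct V j f w ∈ U) :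
    U = ⊥ ∨ U = ⊤ := by
  let N : LieSubmodule ℂ (Ext n) V :=
    { U with
      lie_mem := by
        intro x w hw
        rw [Ext.eq_poly_add_sum x, add_lie, sum_lie]
        exact U.add_mem (hA _ w hw) (U.sum_mem fun j _ => hΦ j _ w hw) }
  have hN : N.toSubmodule = U := rfl
  rcases eq_bot_or_eq_top N with h | h
  · left; rw [← hN, h]; simp
  · right; rw [← hN, h]; simp

end Action

/-! ### The central element of `gl_n` acts by a scalar -/

section Scalar

/-- The part of `V` of degrees between `a` and `b`, where an eigenvector of `E` of
eigenvalue `c + k` has degree `k`. -/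
def degreeRange {V : Type*} [AddCommGroup V] [Module ℂ V] (E : Module.End ℂ V) (c : ℂ) (a b : ℕ) :
    Submodule ℂ V :=
  ⨆ k ∈ Set.Ico a b, E.eigenspace (c + (k : ℕ))

variable {V : Type*} [AddCommGroup V] [Module ℂ V] {E : Module.End ℂ V} {c : ℂ}

theorem eigenspace_le_degreeRange {a b k : ℕ} (h1 : a ≤ k) (h2 : k < b) :
    E.eigenspace (c + (k : ℕ)) ≤ degreeRange E c a b :=
  le_iSup₂_of_le k ⟨h1, h2⟩ le_rfl

theorem degreeRange_mono {a b b' : ℕ} (h : b ≤ b') :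
    degreeRange E c a b ≤ degreeRange E c a b' :=
  iSup₂_le fun _ hk => eigenspace_le_degreeRange hk.1 (hk.2.trans_le h)

theorem map_mem_degreeRange {a b : ℕ} {T : Module.End ℂ V} (h : Commute E T) {w : V}
    (hw : w ∈ degreeRange E c a b) : T w ∈ degreeRange E c a b := by
  have h1 : degreeRange E c a b ≤ (degreeRange E c a b).comap T := by
    refine iSup₂_le fun k hk w hw => ?_
    refine eigenspace_le_degreeRange hk.1 hk.2 ?_
    rw [Module.End.mem_eigenspace_iff] at hw ⊢
    have h2 := congrArg (fun S : Module.End ℂ V => S w) h.eq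
    simp only [Module.End.mul_apply] at h2
    rw [h2, hw, map_smul]
  exact h1 hw

/-- Solving `(E - (c + b)) x = y` for `y` of degree less than `b`. -/
theorem mem_degreeRange_succ {a b : ℕ} (hab : a ≤ b) {x : V}
    (hx : E x - (c + (b : ℕ)) • x ∈ degreeRange E c a b) :
    x ∈ degreeRange E c a (b + 1) := by
  have h1 : degreeRange E c a b
      ≤ (degreeRange E c a b).map (E - algebraMap ℂ _ (c + (b : ℕ))) := by
    refine iSup₂_le fun k hk w hw => ?_
    have h2 : ((k : ℂ) - b) ≠ 0 := sub_ne_zero.mpr (by exact_mod_cast hk.2.ne)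
    refine ⟨((k : ℂ) - b)⁻¹ • w,
      Submodule.smul_mem _ _ (eigenspace_le_degreeRange hk.1 hk.2 hw), ?_⟩
    rw [Module.End.mem_eigenspace_iff] at hw
    rw [map_smul, LinearMap.sub_apply, hw, Module.algebraMap_end_apply, ← sub_smul, smul_smul,
      add_sub_add_left_eq_sub, inv_mul_cancel₀ h2, one_smul]
  obtain ⟨z, hz, hzx⟩ := h1 hx
  have h3 : x - z ∈ E.eigenspace (c + (b : ℕ)) := by
    rw [Module.End.mem_eigenspace_iff, map_sub, smul_sub, sub_eq_sub_iff_sub_eq_sub, ← hzx]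
    rfl
  rw [← sub_add_cancel x z]
  exact Submodule.add_mem _ (eigenspace_le_degreeRange hab (Nat.lt_succ_self b) h3)
    (degreeRange_mono (Nat.le_succ b) hz)

variable {n : ℕ} {A : MvPolynomial (Fin n) ℂ →ₐ[ℂ] Module.End ℂ V}
  {Φ : Fin n → MvPolynomial (Fin n) ℂ →ₗ[ℂ] Module.End ℂ V}

/-- A vector field with homogeneous coefficients of degree `d` raises the degree by at
least `0` and at most `d - 1`, except that constant vector fields preserve it. -/
theorem IsFieldAction.field_mem_degreeRange (h : IsFieldAction A Φ) {a d : ℕ} (j : Fin n)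
    {g : MvPolynomial (Fin n) ℂ} (hg : g.IsHomogeneous d) {w : V}
    (hw : w ∈ (∑ i, matrixUnit A Φ i i).eigenspace (c + (a : ℕ))) :
    Φ j g w ∈ degreeRange (∑ i, matrixUnit A Φ i i) c a (a + (d - 1) + 1) := by
  set E := ∑ i, matrixUnit A Φ i i with hE
  have hw' : w ∈ degreeRange E c a (a + 1) :=
    eigenspace_le_degreeRange le_rfl (Nat.lt_succ_self a) hw
  induction d generalizing g with
  | zero =>
    obtain ⟨b, rfl⟩ : ∃ b, g = C b :=
      ⟨_, totalDegree_eq_zero_iff_eq_C.mp (hg.totalDegree_le.antisymm (Nat.zero_le _))⟩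
    exact map_mem_degreeRange (h.sum_matrixUnit_comm_C j b) hw'
  | succ d ih =>
    have h1 := h.sum_matrixUnit_mul_field_of_isHomogeneous j hg
    rcases Nat.eq_zero_or_pos d with rfl | hd
    · rw [sum_poly_mul_field_pderiv_of_isHomogeneous_one j hg, Nat.cast_zero, zero_smul, zero_sub,
        neg_add_cancel, sub_eq_zero] at h1
      exact map_mem_degreeRange h1 hw'
    · refine mem_degreeRange_succ (Nat.le_add_right _ _) ?_
      rw [← hE] at h1
      have h2 := congrArg (fun S : Module.End ℂ V => S w) h1
      simp only [LinearMap.sub_apply, LinearMap.add_apply, Module.End.mul_apply,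
        LinearMap.smul_apply, LinearMap.sum_apply] at h2
      rw [Module.End.mem_eigenspace_iff] at hw
      rw [hw, map_smul, sub_eq_iff_eq_add] at h2
      have h3 : E (Φ j g w) - (c + ((a + (d + 1 - 1) : ℕ) : ℂ)) • Φ j g w
          = -∑ i, A (X i) (Φ j (pderiv i g) w) + A g (Φ j 1 w) := by
        rw [h2, Nat.add_sub_cancel]
        push_cast
        module
      have h4 : a + (d - 1) + 1 = a + (d + 1 - 1) := by omega
      rw [h3]
      refine Submodule.add_mem _ (Submodule.neg_mem _ (Submodule.sum_mem _ fun i _ => ?_)) ?_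
      · rw [← h4]
        exact map_mem_degreeRange (h.sum_matrixUnit_comm_poly _) (ih hg.pderiv)
      · refine degreeRange_mono (by omega : a + 1 ≤ _) ?_
        exact map_mem_degreeRange (h.sum_matrixUnit_comm_poly _)
          (map_mem_degreeRange (h.sum_matrixUnit_comm_d j) hw')

variable [LieRingModule (Ext n) V] [LieModule ℂ (Ext n) V]

/-- On a simple module, `∑ i, t_i ∂_i - t_i · ∂_i` acts by a scalar as soon as it has an
eigenvector. Polynomials and vector fields do not lower the degree, so that the vectors of degree at
least `m` form a submodule: for `m = 0` it is everything, for `m = 1` it vanishes. -/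
theorem sum_matrixUnit_apply_eq_smul (hAW : IsAWModule n V)
    (hsimple : LieModule.IsIrreducible ℂ (Ext n) V) {v : V} (hv : v ≠ 0) {c : ℂ}
    (hvc : (∑ i, matrixUnit (polyAct hAW) (fieldAct V) i i) v = c • v) (w : V) :
    (∑ i, matrixUnit (polyAct hAW) (fieldAct V) i i) w = c • w := by
  set E := ∑ i, matrixUnit (polyAct hAW) (fieldAct V) i i with hE
  have h := isFieldAction hAW
  let S : ℕ → Submodule ℂ V := fun m => ⨆ k : {k : ℕ // m ≤ k}, E.eigenspace (c + (k.1 : ℕ))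
  have hle : ∀ {m k : ℕ}, m ≤ k → E.eigenspace (c + (k : ℕ)) ≤ S m := fun {m k} hk =>
    le_iSup_of_le (⟨k, hk⟩ : {k : ℕ // m ≤ k}) le_rfl
  have hle' : ∀ {m a b : ℕ}, m ≤ a → degreeRange E c a b ≤ S m := fun {m a b} hm =>
    iSup₂_le fun k hk => hle (hm.trans hk.1)
  have hS : ∀ m, S m = ⊥ ∨ S m = ⊤ := by
    intro m
    refine eq_bot_or_eq_top_of_stable hAW hsimple (S m) (fun f => ?_) (fun j f => ?_)
    · change S m ≤ (S m).comap (polyAct hAW f)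
      refine iSup_le fun k w hw => hle' k.2 (b := k.1 + 1) ?_
      exact map_mem_degreeRange (h.sum_matrixUnit_comm_poly f)
        (eigenspace_le_degreeRange le_rfl (Nat.lt_succ_self _) hw)
    · change S m ≤ (S m).comap (fieldAct V j f)
      refine iSup_le fun k w hw => ?_
      rw [Submodule.mem_comap]
      induction f using MvPolynomial.induction_on' with
      | monomial u a =>
        exact hle' k.2 (h.field_mem_degreeRange j (isHomogeneous_monomial a rfl) hw)
      | add p q hp hq =>
        rw [map_add]
        exact Submodule.add_mem _ hp hq
  have hv0 : v ∈ E.eigenspace (c + ((0 : ℕ) : ℂ)) := by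
    rw [Module.End.mem_eigenspace_iff, Nat.cast_zero, add_zero, hvc]
  have hdisj : Disjoint (E.eigenspace (c + ((0 : ℕ) : ℂ))) (S 1) := by
    have h1 := (E.eigenspaces_iSupIndep (c + ((0 : ℕ) : ℂ)))
    refine h1.mono_right (iSup_le fun k => ?_)
    refine le_iSup₂_of_le (c + (k.1 : ℂ)) ?_ le_rfl
    have := k.2
    simp only [Nat.cast_zero, ne_eq, add_right_inj, Nat.cast_eq_zero]
    omega
  have h1 : S 1 = ⊥ := by
    refine (hS 1).resolve_right fun htop => hv ?_
    rw [htop, disjoint_top] at hdisj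
    rwa [hdisj, Submodule.mem_bot] at hv0
  have h0 : S 0 = ⊤ := by
    refine (hS 0).resolve_left fun hbot => hv ?_
    have := hle (Nat.zero_le 0) hv0
    rwa [hbot, Submodule.mem_bot] at this
  have h2 : S 0 ≤ E.eigenspace (c + ((0 : ℕ) : ℂ)) := by
    refine iSup_le fun k => ?_
    rcases Nat.eq_zero_or_pos k.1 with hk | hk
    · rw [hk]
    · exact (hle hk).trans (h1.trans_le bot_le)
  have h3 : w ∈ E.eigenspace (c + ((0 : ℕ) : ℂ)) := h2 (h0 ▸ Submodule.mem_top)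
  rwa [Module.End.mem_eigenspace_iff, Nat.cast_zero, add_zero] at h3

end Scalar

/-! ### Joint eigenvectors -/

section Eigenvector

theorem exists_joint_eigenvector {V : Type*} [AddCommGroup V] [Module ℂ V] {m : ℕ}
    (T : Fin m → Module.End ℂ V) (hT : ∀ i j, Commute (T i) (T j)) (W : Submodule ℂ V) (hW : W ≠ ⊥)
    [FiniteDimensional ℂ W] (hTW : ∀ i, ∀ w ∈ W, T i w ∈ W) :
    ∃ v ∈ W, v ≠ 0 ∧ ∃ μ : Fin m → ℂ, ∀ i, T i v = μ i • v := by
  -- Cut `W` down to an eigenspace of one operator after the other.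
  have key : ∀ s : Finset (Fin m), ∃ U : Submodule ℂ V, U ≤ W ∧ U ≠ ⊥ ∧
      (∀ i, ∀ w ∈ U, T i w ∈ U) ∧ ∃ μ : Fin m → ℂ, ∀ i ∈ s, ∀ w ∈ U, T i w = μ i • w := by
    intro s
    induction s using Finset.induction_on with
    | empty => exact ⟨W, le_rfl, hW, hTW, 0, by simp⟩
    | insert a s ha ih =>
      obtain ⟨U, hUW, hU, hTU, μ, hμ⟩ := ih
      have : FiniteDimensional ℂ U := Submodule.finiteDimensional_of_le hUW
      have : Nontrivial U := Submodule.nontrivial_iff_ne_bot.mpr hU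
      obtain ⟨ν, hν⟩ := Module.End.exists_eigenvalue ((T a).restrict (hTU a))
      obtain ⟨x, hx⟩ := hν.exists_hasEigenvector
      refine ⟨U ⊓ (T a).eigenspace ν, inf_le_left.trans hUW, ?_, ?_, Function.update μ a ν, ?_⟩
      · refine (Submodule.ne_bot_iff _).mpr ⟨x, ⟨x.2, ?_⟩, fun h0 => hx.2 (Subtype.ext h0)⟩
        rw [SetLike.mem_coe, Module.End.mem_eigenspace_iff]
        exact congrArg Subtype.val hx.apply_eq_smul
      · rintro i w ⟨hw, hwa⟩
        refine ⟨hTU i w hw, ?_⟩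
        rw [SetLike.mem_coe, Module.End.mem_eigenspace_iff] at hwa ⊢
        have h2 := congrArg (fun S : Module.End ℂ V => S w) (hT a i).eq
        simp only [Module.End.mul_apply] at h2
        rw [h2, hwa, map_smul]
      · rintro i hi w ⟨hw, hwa⟩
        rw [SetLike.mem_coe, Module.End.mem_eigenspace_iff] at hwa
        by_cases hia : i = a
        · subst hia; rw [Function.update_self, hwa]
        · rw [Function.update_of_ne hia]
          exact hμ i ((Finset.mem_insert.mp hi).resolve_left hia) w hw
  obtain ⟨U, hUW, hU, -, μ, hμ⟩ := key Finset.univ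
  obtain ⟨v, hv, hv0⟩ := (Submodule.ne_bot_iff _).mp hU
  exact ⟨v, hUW hv, hv0, μ, fun i => hμ i (Finset.mem_univ i) v hv⟩

variable {n : ℕ} {V : Type*} [AddCommGroup V] [Module ℂ V] [LieRingModule (Ext n) V]
  [LieModule ℂ (Ext n) V]

theorem IsFieldAction.commute_poly_mul_field {R : Type*} [Ring R] [Algebra ℂ R]
    {A : MvPolynomial (Fin n) ℂ →ₐ[ℂ] R} {Φ : Fin n → MvPolynomial (Fin n) ℂ →ₗ[ℂ] R}
    (h : IsFieldAction A Φ) (i j : Fin n) :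
    Commute (A (X i) * Φ i 1) (A (X j) * Φ j 1) := by
  have hd : Φ i 1 * Φ j 1 = Φ j 1 * Φ i 1 := by
    have := h.comm_field i j 1 1
    rw [(pderiv i).map_one_eq_zero, (pderiv j).map_one_eq_zero, mul_zero, map_zero, map_zero,
      sub_zero] at this
    exact sub_eq_zero.mp this
  have ht : A (X i) * A (X j) = A (X j) * A (X i) := by rw [← map_mul, mul_comm, map_mul]
  by_cases hij : i = j
  · subst hij; exact Commute.refl _
  · have h1 := h.comm_poly' i 1 (X j)
    have h2 := h.comm_poly' j 1 (X i)
    rw [pderiv_X_of_ne (Ne.symm hij), mul_zero, map_zero, add_zero] at h1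
    rw [pderiv_X_of_ne hij, mul_zero, map_zero, add_zero] at h2
    exact (Commute.mul_right ht h2.symm).mul_left (Commute.mul_right h1 hd)

/-- A nonzero finite-dimensional weight space contains a joint eigenvector of the operators
`t_i · ∂_i`, which commute with the Cartan elements. -/
theorem exists_joint_eigenvector_of_weightSpace (hAW : IsAWModule n V) {lam : Fin n → ℂ}
    (hne : weightSpace V lam ≠ ⊥) (hfin : FiniteDimensional ℂ (weightSpace V lam)) :
    ∃ v : V, v ≠ 0 ∧ ∃ μ ν : Fin n → ℂ,
      (∀ i, (polyAct hAW (X i) * fieldAct V i 1) v = μ i • v) ∧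
      ∀ i, matrixUnit (polyAct hAW) (fieldAct V) i i v = ν i • v := by
  have h := isFieldAction hAW
  have hmem : ∀ w, w ∈ weightSpace V lam ↔ ∀ i, fieldAct V i (X i) w = lam i • w := by
    intro w
    simp only [weightSpace, jointEigenspace, Submodule.mem_iInf, Module.End.mem_eigenspace_iff]
    rfl
  obtain ⟨v, hv, hv0, μ, hμ⟩ := exists_joint_eigenvector
    (fun i => polyAct hAW (X i) * fieldAct V i 1) h.commute_poly_mul_field
    (weightSpace V lam) hne (by
      intro i w hw
      rw [hmem] at hw ⊢
      intro j
      have h1 : Commute (fieldAct V j (X j)) (polyAct hAW (X i) * fieldAct V i 1) := by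
        have h2 : fieldAct V j (X j) = matrixUnit (polyAct hAW) (fieldAct V) j j
            + polyAct hAW (X j) * fieldAct V j 1 := (sub_add_cancel _ _).symm
        rw [h2]
        exact ((h.matrixUnit_comm_poly j j _).mul_right (h.matrixUnit_comm_d j j i)).add_left
          (h.commute_poly_mul_field j i)
      have h3 := congrArg (fun S : Module.End ℂ V => S w) h1.eq
      simp only [Module.End.mul_apply] at h3 ⊢
      rw [h3, hw, map_smul, map_smul])
  refine ⟨v, hv0, μ, fun i => lam i - μ i, hμ, fun i => ?_⟩
  rw [matrixUnit, LinearMap.sub_apply, hμ, (hmem v).mp hv, sub_smul]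

end Eigenvector

end WittPlus

/-! ### Joint eigenspaces of commuting operators -/

section JointEigenspace

variable {n : ℕ} {V : Type*} [AddCommGroup V] [Module ℂ V]

theorem mem_jointEigenspace {T : Fin n → Module.End ℂ V} {α : Fin n → ℂ} {w : V} :
    w ∈ jointEigenspace T α ↔ ∀ i, T i w = α i • w := by
  simp only [jointEigenspace, Submodule.mem_iInf, Module.End.mem_eigenspace_iff]

/-- A stable subspace contains the components of its elements in the joint eigenspaces. -/
theorem mem_of_sum_mem_of_jointEigenspace {ι : Type*} (T : Fin n → Module.End ℂ V)
    (N : Submodule ℂ V) (hN : ∀ i, ∀ w ∈ N, T i w ∈ N) {χ : ι → Fin n → ℂ}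
    (hχ : Function.Injective χ) (s : Finset ι) (w : ι → V)
    (hw : ∀ a ∈ s, w a ∈ jointEigenspace T (χ a)) (hsum : ∑ a ∈ s, w a ∈ N) :
    ∀ a ∈ s, w a ∈ N := by
  classical
  induction s using Finset.induction_on generalizing w with
  | empty => simp
  | insert b s hb ih =>
    have h1 : ∀ a ∈ s, w a ∈ N := by
      intro a ha
      have hab : χ a ≠ χ b := fun h => hb (hχ h ▸ ha)
      obtain ⟨i, hi⟩ := Function.ne_iff.mp hab
      -- `T i - χ b i` kills the component at `b` and rescales the others.
      have h2 : ∑ a ∈ s, (χ a i - χ b i) • w a ∈ N := by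
        have h3 := N.sub_mem (hN i _ hsum) (N.smul_mem (χ b i) hsum)
        rw [Finset.sum_insert hb, map_add, smul_add, map_sum,
          mem_jointEigenspace.mp (hw b (Finset.mem_insert_self b s)) i, add_sub_add_left_eq_sub,
          Finset.smul_sum, ← Finset.sum_sub_distrib] at h3
        rwa [Finset.sum_congr rfl fun a ha => by
          rw [mem_jointEigenspace.mp (hw a (Finset.mem_insert_of_mem ha)) i, ← sub_smul]] at h3
      have h4 := ih (fun a => (χ a i - χ b i) • w a)
        (fun a ha => Submodule.smul_mem _ _ (hw a (Finset.mem_insert_of_mem ha))) h2 a ha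
      exact (N.smul_mem_iff (sub_ne_zero.mpr hi)).mp h4
    intro a ha
    rcases Finset.mem_insert.mp ha with rfl | ha
    · rw [Finset.sum_insert hb] at hsum
      exact (N.add_mem_iff_left (N.sum_mem h1)).mp hsum
    · exact h1 a ha

theorem jointlyDiagonalizable_of_iSup_eq_top {T : Fin n → Module.End ℂ V}
    (h : ⨆ α, jointEigenspace T α = ⊤) : JointlyDiagonalizable T := by
  classical
  refine (DirectSum.isInternal_submodule_iff_iSupIndep_and_iSup_eq_top _).mpr ⟨?_, h⟩
  rw [iSupIndep_iff_finsetSum_eq_zero_imp_eq_zero]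
  intro s w hw hsum a ha
  have h1 := mem_of_sum_mem_of_jointEigenspace T ⊥ (by simp) Function.injective_id s w hw
    (by rw [hsum]; exact Submodule.zero_mem _) a ha
  simpa using h1

end JointEigenspace

/-! ### Weight vectors of modules over the Weyl algebra -/

namespace WeylAlgebra

variable {n : ℕ}

theorem adjoin_generators :
    Algebra.adjoin ℂ (Set.range (t : Fin n → WeylAlgebra n) ∪ Set.range d) = ⊤ := by
  have h1 := congrArg (Subalgebra.map (mk n))
    (FreeAlgebra.adjoin_range_ι (R := ℂ) (X := Fin n ⊕ Fin n))
  rw [AlgHom.map_adjoin, Algebra.map_top,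
    (AlgHom.range_eq_top (mk n)).mpr (RingQuot.mkAlgHom_surjective ℂ (Rel n)),
    ← Set.range_comp] at h1
  rw [← h1, ← Set.Sum.elim_range]
  congr 2
  funext x
  rcases x with i | i <;> rfl

section Module

variable {V : Type*} [AddCommGroup V] [Module ℂ V] [Module (WeylAlgebra n) V]
  [IsScalarTower ℂ (WeylAlgebra n) V]

theorem smul_mem_of_stable (U : Submodule ℂ V) (ht : ∀ i : Fin n, ∀ w ∈ U, t i • w ∈ U)
    (hd : ∀ i : Fin n, ∀ w ∈ U, d i • w ∈ U) (a : WeylAlgebra n) {w : V} (hw : w ∈ U) :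
    a • w ∈ U := by
  have ha : a ∈ Algebra.adjoin ℂ (Set.range (t : Fin n → WeylAlgebra n) ∪ Set.range d) := by
    rw [adjoin_generators]; exact Algebra.mem_top
  induction ha using Algebra.adjoin_induction generalizing w with
  | mem x hx =>
    rcases hx with ⟨i, rfl⟩ | ⟨i, rfl⟩
    exacts [ht i w hw, hd i w hw]
  | algebraMap c => rw [algebraMap_smul]; exact U.smul_mem c hw
  | add x y _ _ hx hy => rw [add_smul]; exact U.add_mem (hx hw) (hy hw)
  | mul x y _ _ hx hy => rw [mul_smul]; exact hx (hy hw)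

/-- A subspace that is stable under the generators `t_i` and `∂_i`, as a submodule. -/
def submoduleOfStable (U : Submodule ℂ V) (ht : ∀ i : Fin n, ∀ w ∈ U, t i • w ∈ U)
    (hd : ∀ i : Fin n, ∀ w ∈ U, d i • w ∈ U) : Submodule (WeylAlgebra n) V :=
  { U with smul_mem' := fun a _ hw => smul_mem_of_stable U ht hd a hw }

variable (n) in
/-- The vector `w` has weight `γ` with respect to the operators `t_i ∂_i`. -/
def IsWeightVector (γ : Fin n → ℂ) (w : V) : Prop :=
  ∀ i : Fin n, (t i * d i) • w = γ i • w

theorem t_d_t (i j : Fin n) : (t j * d j * t i : WeylAlgebra n)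
    = t i * (t j * d j) + if i = j then t i else 0 := by
  rw [mul_assoc, d_mul_t, mul_add, ← mul_assoc, t_mul_t, mul_assoc]
  by_cases h : j = i
  · subst h; simp
  · simp [h, Ne.symm h]

theorem t_d_d (i j : Fin n) : (t j * d j * d i : WeylAlgebra n)
    = d i * (t j * d j) - if i = j then d i else 0 := by
  rw [mul_assoc, d_mul_d, ← mul_assoc, ← mul_assoc, d_mul_t]
  by_cases h : i = j
  · subst h; simp [add_mul]
  · simp [h]

theorem IsWeightVector.t_smul {γ : Fin n → ℂ} {w : V} (h : IsWeightVector n γ w) (i : Fin n) :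
    IsWeightVector n (γ + Pi.single i 1) (t i • w) := by
  intro j
  rw [← mul_smul, t_d_t, add_smul, mul_smul, h j, Pi.add_apply, add_smul, smul_comm]
  by_cases hij : i = j
  · subst hij; simp
  · simp [hij, Ne.symm hij]

theorem IsWeightVector.d_smul {γ : Fin n → ℂ} {w : V} (h : IsWeightVector n γ w) (i : Fin n) :
    IsWeightVector n (γ - Pi.single i 1) (d i • w) := by
  intro j
  rw [← mul_smul, t_d_d, sub_smul, mul_smul, h j, Pi.sub_apply, sub_smul, smul_comm]
  by_cases hij : i = j
  · subst hij; simp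
  · simp [hij, Ne.symm hij]

theorem IsWeightVector.d_t_smul {γ : Fin n → ℂ} {w : V} (h : IsWeightVector n γ w) (i : Fin n) :
    d i • t i • w = (γ i + 1) • w := by
  rw [← mul_smul, d_mul_t, if_pos rfl, add_smul, h i, one_smul, add_smul, one_smul]

theorem IsWeightVector.t_d_smul {γ : Fin n → ℂ} {w : V} (h : IsWeightVector n γ w) (i : Fin n) :
    t i • d i • w = γ i • w := by
  rw [← mul_smul, h i]

/-! ### Locally nilpotent vectors -/

theorem pow_succ_mul_of_commute {R : Type*} [Ring R] (a b : R) (h : Commute a (a * b - b * a))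
    (k : ℕ) : a ^ (k + 1) * b = b * a ^ (k + 1) + ((k : R) + 1) * ((a * b - b * a) * a ^ k) := by
  induction k with
  | zero => simp
  | succ k ih =>
    have h1 : a * b = b * a + (a * b - b * a) := (add_sub_cancel _ _).symm
    have h2 : a * (((k : R) + 1) * ((a * b - b * a) * a ^ k))
        = ((k : R) + 1) * ((a * b - b * a) * a ^ (k + 1)) := by
      have h3 : a * ((k : R) + 1) = ((k : R) + 1) * a := by
        rw [mul_add, add_mul, (Nat.cast_commute k a).eq, mul_one, one_mul]
      rw [← mul_assoc, h3, mul_assoc, ← mul_assoc a, h.eq, mul_assoc _ a, ← pow_succ']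
    rw [pow_succ' a (k + 1), mul_assoc, ih, mul_add, ← mul_assoc a b, h2]
    nth_rewrite 1 [h1]
    rw [add_mul, mul_assoc b, Nat.cast_succ]
    noncomm_ring

/-- The vectors on which some power of `a` vanishes. -/
def locallyNilpotent (V : Type*) [AddCommGroup V] [Module ℂ V] [Module (WeylAlgebra n) V]
    [IsScalarTower ℂ (WeylAlgebra n) V] (a : WeylAlgebra n) : Submodule ℂ V where
  carrier := {w | ∃ k : ℕ, a ^ k • w = 0}
  zero_mem' := ⟨0, smul_zero _⟩
  add_mem' := by
    rintro v w ⟨k, hk⟩ ⟨l, hl⟩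
    refine ⟨k + l, ?_⟩
    rw [smul_add, pow_add, mul_smul _ _ w, hl, smul_zero, add_zero, ← pow_add, add_comm, pow_add,
      mul_smul, hk, smul_zero]
  smul_mem' := by
    rintro c w ⟨k, hk⟩
    exact ⟨k, by rw [smul_comm, hk, smul_zero]⟩

theorem smul_mem_locallyNilpotent {a b : WeylAlgebra n} (h : Commute a (a * b - b * a)) {w : V}
    (hw : w ∈ locallyNilpotent V a) : b • w ∈ locallyNilpotent V a := by
  obtain ⟨k, hk⟩ := hw
  refine ⟨k + 1, ?_⟩
  rw [← mul_smul, pow_succ_mul_of_commute a b h, add_smul, mul_smul, mul_smul, mul_smul, hk,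
    pow_succ', mul_smul, hk, smul_zero, smul_zero, smul_zero, smul_zero, add_zero]

theorem commute_t_commutator (i j : Fin n) :
    Commute (t i : WeylAlgebra n) (t i * d j - d j * t i) := by
  rw [d_mul_t]
  split_ifs
  · rw [sub_add_cancel_left]; exact (Commute.one_right _).neg_right
  · rw [sub_add_cancel_left]; exact (Commute.zero_right _).neg_right

theorem commute_d_commutator (i j : Fin n) :
    Commute (d i : WeylAlgebra n) (d i * t j - t j * d i) := by
  rw [d_mul_t]
  split_ifs
  · rw [add_sub_cancel_left]; exact Commute.one_right _
  · rw [add_sub_cancel_left]; exact Commute.zero_right _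

variable (V) in
/-- The submodule of the vectors on which some power of `t_i` vanishes. -/
def tNilpotent (i : Fin n) : Submodule (WeylAlgebra n) V :=
  submoduleOfStable (locallyNilpotent V (t i))
    (fun j _ hw => smul_mem_locallyNilpotent (by rw [t_mul_t, sub_self]; exact .zero_right _) hw)
    (fun j _ hw => smul_mem_locallyNilpotent (commute_t_commutator i j) hw)

variable (V) in
/-- The submodule of the vectors on which some power of `∂_i` vanishes. -/
def dNilpotent (i : Fin n) : Submodule (WeylAlgebra n) V :=
  submoduleOfStable (locallyNilpotent V (d i))
    (fun j _ hw => smul_mem_locallyNilpotent (commute_d_commutator i j) hw)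
    (fun j _ hw => smul_mem_locallyNilpotent (by rw [d_mul_d, sub_self]; exact .zero_right _) hw)

theorem IsWeightVector.exists_of_t_pow {i : Fin n} {k : ℕ} {γ : Fin n → ℂ} {w : V}
    (h : IsWeightVector n γ w) (hw : w ≠ 0) (hk : (t i) ^ k • w = 0) :
    ∃ m : ℕ, γ i + m + 1 = 0 := by
  induction k generalizing γ w with
  | zero => rw [pow_zero, one_smul] at hk; exact absurd hk hw
  | succ k ih =>
    by_cases h0 : t i • w = 0
    · have h1 := h.d_t_smul i
      rw [h0, smul_zero] at h1
      exact ⟨0, by simpa [hw] using h1.symm⟩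
    · rw [pow_succ, mul_smul] at hk
      obtain ⟨m, hm⟩ := ih (h.t_smul i) h0 hk
      refine ⟨m + 1, ?_⟩
      rw [Pi.add_apply, Pi.single_eq_same] at hm
      rw [← hm]; push_cast; ring

theorem IsWeightVector.exists_of_d_pow {i : Fin n} {k : ℕ} {γ : Fin n → ℂ} {w : V}
    (h : IsWeightVector n γ w) (hw : w ≠ 0) (hk : (d i) ^ k • w = 0) :
    ∃ m : ℕ, γ i = m := by
  induction k generalizing γ w with
  | zero => rw [pow_zero, one_smul] at hk; exact absurd hk hw
  | succ k ih =>
    by_cases h0 : d i • w = 0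
    · have h1 := h.t_d_smul i
      rw [h0, smul_zero] at h1
      exact ⟨0, by simpa [hw] using h1.symm⟩
    · rw [pow_succ, mul_smul] at hk
      obtain ⟨m, hm⟩ := ih (h.d_smul i) h0 hk
      refine ⟨m + 1, ?_⟩
      rw [Pi.sub_apply, Pi.single_eq_same, sub_eq_iff_eq_add] at hm
      rw [hm]; push_cast; ring

variable (n V) in
/-- The operators `t_i` and `∂_i` between neighbouring weight spaces of `V` are invertible, except
that both vanish between the weights with `i`-th entries `-1` and `0`. -/
def IsRegular : Prop :=
  ∀ (γ : Fin n → ℂ) (w : V), IsWeightVector n γ w → ∀ i,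
    (γ i = 0 → d i • w = 0) ∧ (γ i = -1 → t i • w = 0)

/-- If no submodule lies strictly between `0` and `V` among those that are stable under some
module endomorphisms, then `V` is regular. Indeed `t_i` and `∂_i` are then injective or locally
nilpotent on `V`; local nilpotency of `t_i` excludes the weights with `i`-th entry `0`, that of
`∂_i` those with `i`-th entry `-1`. -/
theorem isRegular_of_simple {ι : Type*} (e : ι → Module.End (WeylAlgebra n) V)
    (hs : ∀ N : Submodule (WeylAlgebra n) V, (∀ k, ∀ w ∈ N, e k w ∈ N) → N = ⊥ ∨ N = ⊤) :
    IsRegular n V := by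
  have ht : ∀ i, tNilpotent V i = ⊥ ∨ tNilpotent V i = ⊤ := fun i =>
    hs (tNilpotent V i) fun k w ⟨m, hm⟩ => ⟨m, by rw [← map_smul, hm, map_zero]⟩
  have hd : ∀ i, dNilpotent V i = ⊥ ∨ dNilpotent V i = ⊤ := fun i =>
    hs (dNilpotent V i) fun k w ⟨m, hm⟩ => ⟨m, by rw [← map_smul, hm, map_zero]⟩
  intro γ w hw i
  constructor
  · intro hγ
    by_contra h0
    have h1 : d i • w ∈ tNilpotent V i := ⟨1, by rw [pow_one, hw.t_d_smul, hγ, zero_smul]⟩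
    rcases ht i with hb | hb
    · rw [hb] at h1; exact h0 h1
    · have h2 : w ∈ tNilpotent V i := hb ▸ Submodule.mem_top
      obtain ⟨k, hk⟩ := h2
      obtain ⟨m, hm⟩ := hw.exists_of_t_pow (fun h => h0 (by rw [h, smul_zero])) hk
      rw [hγ, zero_add] at hm
      exact Nat.cast_add_one_ne_zero m hm
  · intro hγ
    by_contra h0
    have h1 : t i • w ∈ dNilpotent V i :=
      ⟨1, by rw [pow_one, hw.d_t_smul, hγ, neg_add_cancel, zero_smul]⟩
    rcases hd i with hb | hb
    · rw [hb] at h1; exact h0 h1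
    · have h2 : w ∈ dNilpotent V i := hb ▸ Submodule.mem_top
      obtain ⟨k, hk⟩ := h2
      obtain ⟨m, hm⟩ := hw.exists_of_d_pow (fun h => h0 (by rw [h, smul_zero])) hk
      rw [hγ, eq_comm, ← add_eq_zero_iff_eq_neg] at hm
      exact Nat.cast_add_one_ne_zero m hm

end Module

end WeylAlgebra

/-! ### Cyclic weight modules over the Weyl algebra -/

namespace WeylAlgebra

variable {n : ℕ}

/-- The algebra homomorphism `ℂ[t_1, …, t_n] → K_n⁺` with `X_i ↦ ∂_i`. -/
noncomputable def ofPolyD (n : ℕ) : MvPolynomial (Fin n) ℂ →ₐ[ℂ] WeylAlgebra n :=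
  letI : CommRing (Algebra.adjoin ℂ (Set.range (d : Fin n → WeylAlgebra n))) :=
    { (Algebra.adjoin ℂ (Set.range (d : Fin n → WeylAlgebra n))).toRing with
      mul_comm := (Algebra.isMulCommutative_adjoin ℂ (by
        rintro _ ⟨i, rfl⟩ _ ⟨j, rfl⟩
        exact d_mul_d i j)).is_comm.comm }
  (Algebra.adjoin ℂ (Set.range (d : Fin n → WeylAlgebra n))).val.comp
    (MvPolynomial.aeval fun i => ⟨d i, Algebra.subset_adjoin ⟨i, rfl⟩⟩)

theorem ofPolyD_X (i : Fin n) : ofPolyD n (MvPolynomial.X i) = d i := by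
  simp [ofPolyD]

/-- The monomial `t^p`. -/
noncomputable def tPow (p : Fin n →₀ ℕ) : WeylAlgebra n := ofPoly n (MvPolynomial.monomial p 1)

/-- The monomial `∂^p`. -/
noncomputable def dPow (p : Fin n →₀ ℕ) : WeylAlgebra n := ofPolyD n (MvPolynomial.monomial p 1)

theorem tPow_zero : tPow (0 : Fin n →₀ ℕ) = 1 := by
  rw [tPow, MvPolynomial.monomial_zero', map_one, map_one]

theorem dPow_zero : dPow (0 : Fin n →₀ ℕ) = 1 := by
  rw [dPow, MvPolynomial.monomial_zero', map_one, map_one]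

theorem monomial_add_single_one (p : Fin n →₀ ℕ) (i : Fin n) :
    MvPolynomial.monomial (p + Finsupp.single i 1) (1 : ℂ)
      = MvPolynomial.monomial p 1 * MvPolynomial.X i := by
  rw [MvPolynomial.X, MvPolynomial.monomial_mul, one_mul]

theorem tPow_add_single (p : Fin n →₀ ℕ) (i : Fin n) :
    tPow (p + Finsupp.single i 1) = tPow p * t i := by
  rw [tPow, monomial_add_single_one, map_mul, ofPoly_X, tPow]

theorem tPow_add_single' (p : Fin n →₀ ℕ) (i : Fin n) :
    tPow (p + Finsupp.single i 1) = t i * tPow p := by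
  rw [tPow, monomial_add_single_one, mul_comm, map_mul, ofPoly_X, tPow]

theorem dPow_add_single (p : Fin n →₀ ℕ) (i : Fin n) :
    dPow (p + Finsupp.single i 1) = dPow p * d i := by
  rw [dPow, monomial_add_single_one, map_mul, ofPolyD_X, dPow]

theorem dPow_add_single' (p : Fin n →₀ ℕ) (i : Fin n) :
    dPow (p + Finsupp.single i 1) = d i * dPow p := by
  rw [dPow, monomial_add_single_one, mul_comm, map_mul, ofPolyD_X, dPow]

theorem exists_add_single (p : Fin n →₀ ℕ) (i : Fin n) (h : p i ≠ 0) :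
    ∃ q, p = q + Finsupp.single i 1 :=
  ⟨p - Finsupp.single i 1, (tsub_add_cancel_of_le
    (by rwa [Finsupp.single_le_iff, Nat.one_le_iff_ne_zero])).symm⟩

/-- Induction on the degree of a monomial. -/
theorem exponent_induction {C : (Fin n →₀ ℕ) → Prop} (h0 : C 0)
    (h1 : ∀ p i, C p → C (p + Finsupp.single i 1)) (p : Fin n →₀ ℕ) : C p := by
  obtain ⟨k, hk⟩ : ∃ k, p.degree = k := ⟨_, rfl⟩
  induction k generalizing p with
  | zero => rw [(Finsupp.degree_eq_zero_iff p).mp hk]; exact h0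
  | succ k ih =>
    obtain ⟨i, hi⟩ : ∃ i, p i ≠ 0 := by
      by_contra! h
      rw [show p = 0 from Finsupp.ext h, map_zero] at hk
      exact absurd hk (Nat.succ_ne_zero k).symm
    obtain ⟨q, rfl⟩ := exists_add_single p i hi
    rw [map_add, Finsupp.degree_single] at hk
    exact h1 q i (ih q (Nat.succ.inj hk))

/-- The exponents as a vector of complex numbers. -/
noncomputable def expWeight (p : Fin n →₀ ℕ) : Fin n → ℂ := fun i => p i

theorem expWeight_add_single (p : Fin n →₀ ℕ) (i : Fin n) :
    expWeight (p + Finsupp.single i 1) = expWeight p + Pi.single i 1 := by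
  funext j
  simp only [expWeight, Finsupp.add_apply, Pi.add_apply, Nat.cast_add]
  rw [Finsupp.single_apply, Pi.single_apply]
  simp only [eq_comm (a := i)]
  split_ifs <;> simp

/-- The positive part of an exponent vector. -/
noncomputable def posPart (a : Fin n → ℤ) : Fin n →₀ ℕ :=
  Finsupp.equivFunOnFinite.symm fun i => (a i).toNat

/-- The monomial `t^p ∂^q` with `p - q = a` and disjoint exponents. -/
noncomputable def disjointMonomial (a : Fin n → ℤ) : WeylAlgebra n :=
  tPow (posPart a) * dPow (posPart (-a))

section Module

variable {V : Type*} [AddCommGroup V] [Module ℂ V] [Module (WeylAlgebra n) V]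
  [IsScalarTower ℂ (WeylAlgebra n) V]

theorem IsWeightVector.smul {γ : Fin n → ℂ} {w : V} (h : IsWeightVector n γ w) (c : ℂ) :
    IsWeightVector n γ (c • w) := fun i => by rw [smul_comm, h i, smul_comm]

theorem IsWeightVector.tPow_smul {γ : Fin n → ℂ} {w : V} (h : IsWeightVector n γ w)
    (p : Fin n →₀ ℕ) : IsWeightVector n (γ + expWeight p) (tPow p • w) := by
  induction p using exponent_induction with
  | h0 =>
    have : expWeight (0 : Fin n →₀ ℕ) = 0 := by funext j; simp [expWeight]
    rwa [tPow_zero, one_smul, this, add_zero]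
  | h1 p i ih =>
    rw [tPow_add_single', mul_smul, expWeight_add_single, ← add_assoc]
    exact ih.t_smul i

theorem IsWeightVector.dPow_smul {γ : Fin n → ℂ} {w : V} (h : IsWeightVector n γ w)
    (p : Fin n →₀ ℕ) : IsWeightVector n (γ - expWeight p) (dPow p • w) := by
  induction p using exponent_induction with
  | h0 =>
    have : expWeight (0 : Fin n →₀ ℕ) = 0 := by funext j; simp [expWeight]
    rwa [dPow_zero, one_smul, this, sub_zero]
  | h1 p i ih =>
    rw [dPow_add_single', mul_smul, expWeight_add_single, ← sub_sub]
    exact ih.d_smul i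

theorem IsWeightVector.disjointMonomial_smul {γ : Fin n → ℂ} {w : V} (h : IsWeightVector n γ w)
    (a : Fin n → ℤ) : IsWeightVector n (fun i => γ i + a i) (disjointMonomial a • w) := by
  rw [disjointMonomial, mul_smul]
  convert (h.dPow_smul (posPart (-a))).tPow_smul (posPart a) using 1
  funext i
  have h2 : a i = ((a i).toNat : ℤ) - ((-a i).toNat : ℤ) := by omega
  have h3 : (a i : ℂ) = ((a i).toNat : ℂ) - ((-a i).toNat : ℂ) := by
    conv_lhs => rw [h2]
    push_cast
    rfl
  simp only [Pi.add_apply, Pi.sub_apply, expWeight, posPart,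
    Finsupp.equivFunOnFinite_symm_apply_apply, Pi.neg_apply]
  rw [h3]
  ring

/-- On a weight vector every monomial `t^p ∂^q` acts as a multiple of the one with disjoint
exponents. -/
theorem IsWeightVector.exists_tPow_dPow {γ : Fin n → ℂ} {w : V} (h : IsWeightVector n γ w)
    (p q : Fin n →₀ ℕ) :
    ∃ c : ℂ, (tPow p * dPow q) • w = c • disjointMonomial (fun i => (p i : ℤ) - q i) • w := by
  obtain ⟨k, hk⟩ : ∃ k, p.degree = k := ⟨_, rfl⟩
  induction k using Nat.strong_induction_on generalizing p q with
  | _ k ih =>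
    by_cases hpq : ∃ i, p i ≠ 0 ∧ q i ≠ 0
    · -- Cancel a factor `t_i` against a factor `∂_i`.
      obtain ⟨i, hp, hq⟩ := hpq
      obtain ⟨p, rfl⟩ := exists_add_single p i hp
      obtain ⟨q, rfl⟩ := exists_add_single q i hq
      rw [map_add, Finsupp.degree_single] at hk
      obtain ⟨c, hc⟩ := ih p.degree (by omega) p q rfl
      refine ⟨(γ - expWeight q) i * c, ?_⟩
      rw [tPow_add_single, dPow_add_single', mul_smul, mul_smul, mul_smul,
        (h.dPow_smul q).t_d_smul, smul_comm, ← mul_smul, hc, smul_smul]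
      congr 3
      funext j
      simp
    · push Not at hpq
      refine ⟨1, ?_⟩
      have h1 : posPart (fun i => (p i : ℤ) - q i) = p := by
        ext i
        have := hpq i
        simp only [posPart, Finsupp.equivFunOnFinite_symm_apply_apply]
        omega
      have h2 : posPart (-fun i => (p i : ℤ) - q i) = q := by
        ext i
        have := hpq i
        simp only [posPart, Finsupp.equivFunOnFinite_symm_apply_apply, Pi.neg_apply]
        omega
      rw [disjointMonomial, h1, h2, one_smul]

/-- The cyclic module generated by a weight vector `v` is spanned by the vectors `t^p ∂^q v` with
disjoint exponents. -/
theorem IsWeightVector.mem_span_disjointMonomial {γ : Fin n → ℂ} {v : V}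
    (h : IsWeightVector n γ v) (a : WeylAlgebra n) :
    a • v ∈ Submodule.span ℂ (Set.range fun b => (disjointMonomial b : WeylAlgebra n) • v) := by
  set S := Submodule.span ℂ (Set.range fun b => (disjointMonomial b : WeylAlgebra n) • v)
  have h0 : ∀ p q : Fin n →₀ ℕ, (tPow p * dPow q) • v ∈ S := by
    intro p q
    obtain ⟨c, hc⟩ := h.exists_tPow_dPow p q
    rw [hc]
    exact S.smul_mem c (Submodule.subset_span ⟨_, rfl⟩)
  -- The vectors `f g v` with `f` a polynomial in the `t_i` and `g` a monomial in the `∂_i`.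
  have h1 : ∀ f (q : Fin n →₀ ℕ), (ofPoly n f * dPow q) • v ∈ S := by
    intro f q
    induction f using MvPolynomial.induction_on' with
    | monomial u c =>
      have : MvPolynomial.monomial u c = c • MvPolynomial.monomial u (1 : ℂ) := by
        rw [MvPolynomial.smul_monomial, smul_eq_mul, mul_one]
      rw [this, map_smul, smul_mul_assoc, smul_assoc]
      exact S.smul_mem c (h0 u q)
    | add f g hf hg =>
      rw [map_add, add_mul, add_smul]
      exact S.add_mem hf hg
  have h2 : S = Submodule.span ℂ
      (Set.range fun x : MvPolynomial (Fin n) ℂ × (Fin n →₀ ℕ) =>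
        (ofPoly n x.1 * dPow x.2) • v) := by
    apply le_antisymm
    · refine Submodule.span_mono ?_
      rintro _ ⟨b, rfl⟩
      exact ⟨(MvPolynomial.monomial (posPart b) 1, posPart (-b)), rfl⟩
    · rw [Submodule.span_le]
      rintro _ ⟨x, rfl⟩
      exact h1 x.1 x.2
  refine smul_mem_of_stable S (fun i => ?_) (fun i => ?_) a ?_
  · change S ≤ S.comap (Algebra.lsmul ℂ ℂ V (t i))
    conv_lhs => rw [h2]
    rw [Submodule.span_le]
    rintro _ ⟨x, rfl⟩
    change t i • (ofPoly n x.1 * dPow x.2) • v ∈ S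
    rw [← mul_smul, ← mul_assoc, ← ofPoly_X, ← map_mul]
    exact h1 _ _
  · change S ≤ S.comap (Algebra.lsmul ℂ ℂ V (d i))
    conv_lhs => rw [h2]
    rw [Submodule.span_le]
    rintro _ ⟨x, rfl⟩
    change d i • (ofPoly n x.1 * dPow x.2) • v ∈ S
    rw [← mul_smul, ← mul_assoc, d_mul_ofPoly, add_mul, add_smul, mul_assoc, ← dPow_add_single']
    exact S.add_mem (h1 _ _) (h1 _ _)
  · have h3 := h0 0 0
    rwa [tPow_zero, dPow_zero, one_mul, one_smul] at h3

theorem IsRegular.exists_dPow_tPow (hreg : IsRegular n V) {γ : Fin n → ℂ} {w : V}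
    (h : IsWeightVector n γ w) (p : Fin n →₀ ℕ) (hp : tPow p • w ≠ 0) :
    ∃ c : ℂ, c ≠ 0 ∧ dPow p • tPow p • w = c • w := by
  induction p using exponent_induction generalizing γ w with
  | h0 => exact ⟨1, one_ne_zero, by rw [tPow_zero, dPow_zero, one_smul, one_smul, one_smul]⟩
  | h1 p i ih =>
    rw [tPow_add_single, mul_smul] at hp ⊢
    obtain ⟨c, hc, hcw⟩ := ih (h.t_smul i) hp
    have hi : γ i + 1 ≠ 0 := fun h0 => hp <| by
      rw [(hreg γ w h i).2 (eq_neg_of_add_eq_zero_left h0), smul_zero]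
    refine ⟨c * (γ i + 1), mul_ne_zero hc hi, ?_⟩
    rw [dPow_add_single', mul_smul, hcw, smul_comm, h.d_t_smul, smul_smul]

theorem IsRegular.exists_tPow_dPow (hreg : IsRegular n V) {γ : Fin n → ℂ} {w : V}
    (h : IsWeightVector n γ w) (p : Fin n →₀ ℕ) (hp : dPow p • w ≠ 0) :
    ∃ c : ℂ, c ≠ 0 ∧ tPow p • dPow p • w = c • w := by
  induction p using exponent_induction generalizing γ w with
  | h0 => exact ⟨1, one_ne_zero, by rw [tPow_zero, dPow_zero, one_smul, one_smul, one_smul]⟩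
  | h1 p i ih =>
    rw [dPow_add_single, mul_smul] at hp ⊢
    obtain ⟨c, hc, hcw⟩ := ih (h.d_smul i) hp
    have hi : γ i ≠ 0 := fun h0 => hp <| by rw [(hreg γ w h i).1 h0, smul_zero]
    refine ⟨c * γ i, mul_ne_zero hc hi, ?_⟩
    rw [tPow_add_single', mul_smul, hcw, smul_comm, h.t_d_smul, smul_smul]

/-- In a regular module the passage from a weight vector to a monomial multiple of it can be
reversed. -/
theorem IsRegular.exists_smul_disjointMonomial (hreg : IsRegular n V) {γ : Fin n → ℂ} {v : V}
    (h : IsWeightVector n γ v) (a : Fin n → ℤ) (ha : (disjointMonomial a : WeylAlgebra n) • v ≠ 0) :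
    ∃ b : WeylAlgebra n, b • (disjointMonomial a : WeylAlgebra n) • v = v := by
  rw [disjointMonomial, mul_smul] at ha ⊢
  have ha' : dPow (posPart (-a)) • v ≠ 0 := fun h0 => ha (by rw [h0, smul_zero])
  obtain ⟨c, hc, hcv⟩ := hreg.exists_dPow_tPow (h.dPow_smul _) _ ha
  obtain ⟨e, he, hev⟩ := hreg.exists_tPow_dPow h _ ha'
  refine ⟨(e⁻¹ * c⁻¹) • (tPow (posPart (-a)) * dPow (posPart a)), ?_⟩
  rw [smul_assoc, mul_smul (tPow _), hcv, smul_comm (tPow _) c, hev, smul_smul, smul_smul]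
  rw [show e⁻¹ * c⁻¹ * c * e = 1 by field_simp, one_smul]

theorem mem_jointEigenspace_iff {γ : Fin n → ℂ} {w : V} :
    w ∈ jointEigenspace (fun i : Fin n => Algebra.lsmul ℂ ℂ V (t i * d i : WeylAlgebra n)) γ
      ↔ IsWeightVector n γ w := mem_jointEigenspace

theorem shift_injective (γ : Fin n → ℂ) :
    Function.Injective fun (a : Fin n → ℤ) (i : Fin n) => γ i + (a i : ℂ) := by
  intro a b hab
  funext i
  exact Int.cast_injective (add_left_cancel (congrFun hab i))

/-- A weight vector of a regular module generates a simple module: a nonzero submodule contains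
some nonzero monomial multiple of the generator. -/
theorem IsRegular.isSimpleModule_span (hreg : IsRegular n V) {γ : Fin n → ℂ} {v : V} (hv : v ≠ 0)
    (h : IsWeightVector n γ v) :
    IsSimpleModule (WeylAlgebra n) (Submodule.span (WeylAlgebra n) {v}) := by
  rw [isSimpleModule_iff_isAtom, isAtom_iff_le_of_ge]
  refine ⟨by rwa [ne_eq, Submodule.span_singleton_eq_bot], fun N hN hle => ?_⟩
  rw [Submodule.span_singleton_le_iff_mem]
  obtain ⟨x, hx, hx0⟩ := (Submodule.ne_bot_iff N).mp hN
  obtain ⟨a, rfl⟩ := Submodule.mem_span_singleton.mp (hle hx)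
  obtain ⟨c, hc⟩ := (Finsupp.mem_span_range_iff_exists_finsupp).mp (h.mem_span_disjointMonomial a)
  rw [← hc, Finsupp.sum] at hx hx0
  obtain ⟨b, hb, hb0⟩ := Finset.exists_ne_zero_of_sum_ne_zero hx0
  have h1 := mem_of_sum_mem_of_jointEigenspace
    (fun i : Fin n => Algebra.lsmul ℂ ℂ V (t i * d i : WeylAlgebra n)) (N.restrictScalars ℂ)
    (fun i w hw => N.smul_mem _ hw) (shift_injective γ) c.support
    (fun b => c b • (disjointMonomial b : WeylAlgebra n) • v)
    (fun b _ => mem_jointEigenspace_iff.mpr ((h.disjointMonomial_smul b).smul _)) hx b hb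
  rw [Submodule.restrictScalars_mem] at h1
  obtain ⟨k, hk⟩ := hreg.exists_smul_disjointMonomial h b (right_ne_zero_of_smul hb0)
  rw [← hk]
  refine N.smul_mem k ?_
  have h2 := N.smul_of_tower_mem (c b)⁻¹ h1
  rwa [smul_smul, inv_mul_cancel₀ (left_ne_zero_of_smul hb0), one_smul] at h2

theorem isWeightModule_span {γ : Fin n → ℂ} {v : V} (h : IsWeightVector n γ v) :
    WeylAlgebra.IsWeightModule n (Submodule.span (WeylAlgebra n) {v}) := by
  refine jointlyDiagonalizable_of_iSup_eq_top (eq_top_iff.mpr ?_)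
  rintro ⟨x, hx⟩ -
  obtain ⟨a, rfl⟩ := Submodule.mem_span_singleton.mp hx
  have hv : v ∈ Submodule.span (WeylAlgebra n) {v} := Submodule.mem_span_singleton_self v
  have h' : IsWeightVector n γ (⟨v, hv⟩ : Submodule.span (WeylAlgebra n) {v}) := fun i =>
    Subtype.ext (h i)
  have h1 := h'.mem_span_disjointMonomial a
  refine (Submodule.span_le.mpr ?_ : Submodule.span ℂ _ ≤ _) h1
  rintro _ ⟨b, rfl⟩
  exact le_iSup (jointEigenspace _) _ (mem_jointEigenspace_iff.mpr (h'.disjointMonomial_smul b))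

/-- The cyclic module generated by a weight vector has a basis of weight vectors with distinct
weights. -/
theorem exists_basis_span {γ : Fin n → ℂ} {v : V} (h : IsWeightVector n γ v) :
    ∃ (ι : Type) (b : Module.Basis ι ℂ (Submodule.span (WeylAlgebra n) {v}))
      (χ : ι → Fin n → ℂ), Function.Injective χ ∧ ∀ k, IsWeightVector n (χ k) (b k) := by
  set P := Submodule.span (WeylAlgebra n) {v}
  have hv : v ∈ P := Submodule.mem_span_singleton_self v
  have h' : IsWeightVector n γ (⟨v, hv⟩ : P) := fun i => Subtype.ext (h i)
  let x : (Fin n → ℤ) → P := fun a => (disjointMonomial a : WeylAlgebra n) • (⟨v, hv⟩ : P)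
  have hx : ∀ a, IsWeightVector n (fun i => γ i + (a i : ℂ)) (x a) := fun a =>
    h'.disjointMonomial_smul a
  let ι := {a : Fin n → ℤ // x a ≠ 0}
  have hli : LinearIndependent ℂ (fun k : ι => x k.1) := by
    rw [linearIndependent_iff']
    intro s c hc k hk
    have h1 := mem_of_sum_mem_of_jointEigenspace
      (fun i : Fin n => Algebra.lsmul ℂ ℂ P (t i * d i : WeylAlgebra n)) ⊥ (by simp)
      ((shift_injective γ).comp Subtype.val_injective) s (fun k : ι => c k • x k.1)
      (fun k _ => mem_jointEigenspace_iff.mpr ((hx k.1).smul _))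
      (by rw [hc]; exact Submodule.zero_mem _) k hk
    exact (smul_eq_zero.mp ((Submodule.mem_bot ℂ).mp h1)).resolve_right k.2
  have hsp : ⊤ ≤ Submodule.span ℂ (Set.range fun k : ι => x k.1) := by
    rintro ⟨y, hy⟩ -
    obtain ⟨a, rfl⟩ := Submodule.mem_span_singleton.mp hy
    refine (Submodule.span_le.mpr ?_ : Submodule.span ℂ _ ≤ _) (h'.mem_span_disjointMonomial a)
    rintro _ ⟨a, rfl⟩
    by_cases ha : x a = 0
    · change x a ∈ _
      rw [ha]; exact Submodule.zero_mem _
    · exact Submodule.subset_span ⟨⟨a, ha⟩, rfl⟩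
  refine ⟨ι, Module.Basis.mk hli hsp, _, (shift_injective γ).comp Subtype.val_injective,
    fun k => ?_⟩
  rw [Module.Basis.mk_apply]
  exact hx k.1

end Module

end WeylAlgebra

/-! ### The multiplicity space of a simple submodule -/

section Multiplicity

variable {n : ℕ}

theorem GLie.single_eq_smul (i j : Fin n) (x : ℂ) :
    (Matrix.single i j x : GLie n) = x • Matrix.single i j 1 := by
  rw [Matrix.smul_single, smul_eq_mul, mul_one]

/-- The linear map on matrices with prescribed values on the matrix units. -/
noncomputable def GLie.linearOfMatrixUnits {R : Type*} [Ring R] [Algebra ℂ R]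
    (e : Fin n → Fin n → R) : GLie n →ₗ[ℂ] R where
  toFun a := ∑ i, ∑ j, a i j • e i j
  map_add' a b := by simp [add_smul, Finset.sum_add_distrib]
  map_smul' c a := by simp [Finset.smul_sum, smul_smul]

theorem GLie.linearOfMatrixUnits_single {R : Type*} [Ring R] [Algebra ℂ R]
    (e : Fin n → Fin n → R) (i j : Fin n) :
    GLie.linearOfMatrixUnits e (Matrix.single i j 1) = e i j := by
  change ∑ k, ∑ l, (Matrix.single i j (1 : ℂ) : GLie n) k l • e k l = e i j
  rw [Finset.sum_eq_single i, Finset.sum_eq_single j]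
  · simp
  · intro l _ hl; simp [hl.symm]
  · simp
  · intro k _ hk; simp [hk.symm]
  · simp

/-- A family of elements of an associative algebra that satisfies the commutation relations of the
matrix units defines a representation of `gl_n`. -/
noncomputable def GLie.homOfMatrixUnits {R : Type*} [Ring R] [Algebra ℂ R] (e : Fin n → Fin n → R)
    (he : ∀ i j k l, e i j * e k l - e k l * e i j
      = (if j = k then e i l else 0) - (if l = i then e k j else 0)) : GLie n →ₗ⁅ℂ⁆ R where
  toLinearMap := GLie.linearOfMatrixUnits e
  map_lie' := by
    intro a b
    change GLie.linearOfMatrixUnits e ⁅a, b⁆ = GLie.linearOfMatrixUnits e a *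
      GLie.linearOfMatrixUnits e b - GLie.linearOfMatrixUnits e b * GLie.linearOfMatrixUnits e a
    set L := GLie.linearOfMatrixUnits e with hLdef
    have hL : ∀ i j, L (Matrix.single i j 1) = e i j := GLie.linearOfMatrixUnits_single e
    induction a using Matrix.induction_on' with
    | h_zero => simp
    | h_add p q hp hq => rw [add_lie, map_add, hp, hq, map_add]; noncomm_ring
    | h_std_basis i j x =>
      induction b using Matrix.induction_on' with
      | h_zero => simp
      | h_add p q hp hq => rw [lie_add, map_add, hp, hq, map_add]; noncomm_ring
      | h_std_basis k l y =>
        rw [GLie.single_eq_smul i j x, GLie.single_eq_smul k l y, smul_lie, lie_smul, map_smul,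
          map_smul, map_smul, map_smul, hL, hL, smul_mul_smul_comm, smul_mul_smul_comm,
          mul_comm y x, ← smul_sub, he, smul_smul, LieRing.of_associative_ring_bracket, map_sub]
        congr 2
        · split_ifs with h
          · subst h; rw [Matrix.single_mul_single_same, one_mul, hL]
          · rw [Matrix.single_mul_single_of_ne _ _ _ _ h, map_zero]
        · split_ifs with h
          · subst h; rw [Matrix.single_mul_single_same, one_mul, hL]
          · rw [Matrix.single_mul_single_of_ne _ _ _ _ h, map_zero]

theorem GLie.homOfMatrixUnits_single {R : Type*} [Ring R] [Algebra ℂ R] (e : Fin n → Fin n → R)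
    (he) (i j : Fin n) : GLie.homOfMatrixUnits e he (Matrix.single i j 1) = e i j :=
  GLie.linearOfMatrixUnits_single e i j

variable {V : Type*} [AddCommGroup V] [Module ℂ V] [Module (WeylAlgebra n) V]
  [IsScalarTower ℂ (WeylAlgebra n) V]

/-- The space `Hom_{K_n⁺}(P, V)` of a submodule `P ⊆ V`. The Lie algebra `gl_n` acts on it through a
representation `L` on `V` that commutes with the Weyl algebra. -/
noncomputable def MultiplicitySpace (_L : GLie n →ₗ⁅ℂ⁆ Module.End (WeylAlgebra n) V)
    (P : Submodule (WeylAlgebra n) V) : Type _ := P →ₗ[WeylAlgebra n] V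

namespace MultiplicitySpace

variable (L : GLie n →ₗ⁅ℂ⁆ Module.End (WeylAlgebra n) V) (P : Submodule (WeylAlgebra n) V)

instance : AddCommGroup (MultiplicitySpace L P) :=
  inferInstanceAs (AddCommGroup (P →ₗ[WeylAlgebra n] V))

instance : Module ℂ (MultiplicitySpace L P) :=
  inferInstanceAs (Module ℂ (P →ₗ[WeylAlgebra n] V))

instance : FunLike (MultiplicitySpace L P) P V :=
  inferInstanceAs (FunLike (P →ₗ[WeylAlgebra n] V) P V)

instance : LinearMapClass (MultiplicitySpace L P) (WeylAlgebra n) P V :=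
  inferInstanceAs (LinearMapClass (P →ₗ[WeylAlgebra n] V) (WeylAlgebra n) P V)

instance : LieRingModule (GLie n) (MultiplicitySpace L P) where
  bracket a f := (L a).comp f
  add_lie a b f := by
    change (L (a + b)).comp f = (L a).comp f + (L b).comp f
    rw [map_add]; rfl
  lie_add a f g := LinearMap.comp_add f g (L a)
  leibniz_lie a b f := by
    change (L a).comp ((L b).comp f) = (L ⁅a, b⁆).comp f + (L b).comp ((L a).comp f)
    rw [LieHom.map_lie]
    exact LinearMap.ext fun p => (sub_add_cancel _ _).symm

instance : LieModule ℂ (GLie n) (MultiplicitySpace L P) where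
  smul_lie c a f := by
    change (L (c • a)).comp f = c • (L a).comp f
    rw [map_smul]; rfl
  lie_smul c a f := LinearMap.comp_smul (L a) c f

variable {L P}

@[ext]
theorem ext {f g : MultiplicitySpace L P} (h : ∀ p, f p = g p) : f = g := DFunLike.ext f g h

theorem lie_apply (a : GLie n) (f : MultiplicitySpace L P) (p : P) : ⁅a, f⁆ p = L a (f p) := rfl

theorem smul_apply (c : ℂ) (f : MultiplicitySpace L P) (p : P) : (c • f) p = c • f p := rfl

theorem zero_apply (p : P) : (0 : MultiplicitySpace L P) p = 0 := rfl

theorem map_smul_complex (f : MultiplicitySpace L P) (c : ℂ) (p : P) : f (c • p) = c • f p := by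
  rw [← algebraMap_smul (WeylAlgebra n) c p, map_smul, algebraMap_smul]

variable (L P) in
/-- The inclusion `P ⊆ V` as an element of the multiplicity space. -/
noncomputable def incl : MultiplicitySpace L P := P.subtype

theorem incl_apply (p : P) : incl L P p = p := rfl

variable (L P) in
/-- The evaluation map `P ⊗ Hom(P, V) → V`. -/
noncomputable def eval : P ⊗[ℂ] MultiplicitySpace L P →ₗ[ℂ] V :=
  TensorProduct.lift (LinearMap.mk₂ ℂ (fun p f => f p) (fun p q f => map_add f p q)
    (fun c p f => map_smul_complex f c p) (fun _ _ _ => rfl) (fun _ _ _ => rfl))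

@[simp]
theorem eval_tmul (p : P) (f : MultiplicitySpace L P) : eval L P (p ⊗ₜ f) = f p := rfl

/-- Evaluation is injective: expand in a basis of `P` of weight vectors with distinct weights. The
terms then have distinct weights in `V`, hence vanish one by one, and a nonzero homomorphism out
of a simple module is injective. -/
theorem eval_injective [IsSimpleModule (WeylAlgebra n) P] {ι : Type*} (b : Module.Basis ι ℂ P)
    {χ : ι → Fin n → ℂ} (hχ : Function.Injective χ)
    (hb : ∀ k, WeylAlgebra.IsWeightVector n (χ k) (b k)) : Function.Injective (eval L P) := by
  classical
  rw [injective_iff_map_eq_zero]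
  intro x hx
  obtain ⟨g, rfl⟩ := (TensorProduct.equivFinsuppOfBasisLeft b).symm.surjective x
  rw [TensorProduct.equivFinsuppOfBasisLeft_symm_apply, Finsupp.sum, map_sum] at hx
  simp only [eval_tmul] at hx
  have h1 : ∀ k ∈ g.support, g k (b k) ∈ (⊥ : Submodule ℂ V) := by
    refine mem_of_sum_mem_of_jointEigenspace
      (fun i : Fin n => Algebra.lsmul ℂ ℂ V (WeylAlgebra.t i * WeylAlgebra.d i : WeylAlgebra n)) ⊥
      (by simp) hχ g.support (fun k => g k (b k)) (fun k _ => ?_)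
      (by rw [hx]; exact Submodule.zero_mem _)
    refine WeylAlgebra.mem_jointEigenspace_iff.mpr fun i => ?_
    rw [← map_smul, hb k i, map_smul_complex]
  have h2 : g = 0 := by
    ext1 k
    by_contra hk
    have h3 : Function.Injective (g k) :=
      (LinearMap.injective_or_eq_zero (g k : P →ₗ[WeylAlgebra n] V)).resolve_right hk
    have h4 : g k (b k) = 0 := (Submodule.mem_bot ℂ).mp (h1 k (Finsupp.mem_support_iff.mpr hk))
    exact b.ne_zero k (h3 (h4.trans (map_zero (g k)).symm))
  rw [h2, map_zero]

/-- The tensors `p ⊗ f` with `f` in a nonzero submodule of the multiplicity space already span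
`V` under evaluation, because their images form a submodule. -/
theorem map_eval_eq_top
    (hs : ∀ N : Submodule (WeylAlgebra n) V, (∀ a, ∀ w ∈ N, L a w ∈ N) → N = ⊥ ∨ N = ⊤)
    (N : LieSubmodule ℂ (GLie n) (MultiplicitySpace L P)) (hN : N ≠ ⊥) :
    (Submodule.span ℂ {x | ∃ p : P, ∃ f ∈ N, p ⊗ₜ[ℂ] f = x}).map (eval L P) = ⊤ := by
  let U : Submodule (WeylAlgebra n) V := ⨆ f : N, LinearMap.range (f.1 : P →ₗ[WeylAlgebra n] V)
  have hmem : ∀ f ∈ N, ∀ p : P, f p ∈ U := fun f hf p =>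
    le_iSup (fun f : N => LinearMap.range (f.1 : P →ₗ[WeylAlgebra n] V)) ⟨f, hf⟩ ⟨p, rfl⟩
  have hU : U = ⊤ := by
    refine (hs U fun a => ?_).resolve_left fun hbot => hN ?_
    · change U ≤ U.comap (L a)
      refine iSup_le ?_
      rintro ⟨f, hf⟩ _ ⟨p, rfl⟩
      exact hmem ⁅a, f⁆ (N.lie_mem hf) p
    · rw [LieSubmodule.eq_bot_iff]
      intro f hf
      ext p
      have := hmem f hf p
      rwa [hbot, Submodule.mem_bot] at this
  rw [eq_top_iff]
  intro w _
  have hw : w ∈ U := hU ▸ Submodule.mem_top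
  induction hw using Submodule.iSup_induction' with
  | mem f x hx =>
    obtain ⟨p, rfl⟩ := hx
    exact ⟨p ⊗ₜ f.1, Submodule.subset_span ⟨p, f.1, f.2, rfl⟩, rfl⟩
  | zero => exact Submodule.zero_mem _
  | add x y _ _ hx hy => exact Submodule.add_mem _ (hx trivial) (hy trivial)

theorem incl_ne_zero [Nontrivial P] : incl L P ≠ 0 := by
  obtain ⟨p, hp⟩ := exists_ne (0 : P)
  intro h
  exact hp (Subtype.ext (by rw [← incl_apply (L := L) p, h, zero_apply]; rfl))

theorem eval_surjective [Nontrivial P]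
    (hs : ∀ N : Submodule (WeylAlgebra n) V, (∀ a, ∀ w ∈ N, L a w ∈ N) → N = ⊥ ∨ N = ⊤) :
    Function.Surjective (eval L P) := by
  rw [← LinearMap.range_eq_top, eq_top_iff, ← map_eval_eq_top hs (P := P) ⊤ ?_]
  · exact LinearMap.map_le_range
  · intro h
    have : incl L P ∈ (⊤ : LieSubmodule ℂ (GLie n) (MultiplicitySpace L P)) :=
      LieSubmodule.mem_top _
    rw [h] at this
    exact incl_ne_zero ((LieSubmodule.mem_bot _).mp this)

theorem isIrreducible [Nontrivial P] (hinj : Function.Injective (eval L P))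
    (hs : ∀ N : Submodule (WeylAlgebra n) V, (∀ a, ∀ w ∈ N, L a w ∈ N) → N = ⊥ ∨ N = ⊤) :
    LieModule.IsIrreducible ℂ (GLie n) (MultiplicitySpace L P) := by
  have : Nontrivial (MultiplicitySpace L P) := ⟨incl L P, 0, incl_ne_zero⟩
  refine LieModule.IsIrreducible.mk fun N hN => eq_top_iff.mpr fun g _ => ?_
  obtain ⟨p, hp⟩ := exists_ne (0 : P)
  -- A linear form that does not vanish at `p` contracts `P ⊗ N` into `N` and `p ⊗ g` to a nonzero
  -- multiple of `g`.
  obtain ⟨ξ, hξ⟩ : ∃ ξ : Module.Dual ℂ P, ξ p ≠ 0 := by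
    by_contra! h
    exact hp ((Module.forall_dual_apply_eq_zero_iff ℂ p).mp h)
  let C : P ⊗[ℂ] MultiplicitySpace L P →ₗ[ℂ] MultiplicitySpace L P :=
    (TensorProduct.lid ℂ _).toLinearMap ∘ₗ ξ.rTensor _
  have hC : Submodule.span ℂ {x | ∃ p : P, ∃ f ∈ N, p ⊗ₜ[ℂ] f = x} ≤ N.toSubmodule.comap C := by
    rw [Submodule.span_le]
    rintro _ ⟨q, f, hf, rfl⟩
    exact N.smul_mem (ξ q) hf
  have h1 : eval L P (p ⊗ₜ g) ∈ (Submodule.span ℂ {x | ∃ p : P, ∃ f ∈ N, p ⊗ₜ[ℂ] f = x}).map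
      (eval L P) := map_eval_eq_top hs N hN ▸ Submodule.mem_top
  obtain ⟨y, hy, hyg⟩ := h1
  have h2 : C y ∈ N.toSubmodule := hC hy
  rw [hinj hyg] at h2
  exact (N.toSubmodule.smul_mem_iff hξ).mp h2

/-- If the diagonal matrices act by scalars on the inclusion of `P`, then they are diagonalizable
on the multiplicity space, since the sum of the joint eigenspaces is a submodule. -/
theorem isWeightModule [Nontrivial P]
    (hirr : LieModule.IsIrreducible ℂ (GLie n) (MultiplicitySpace L P)) {ν : Fin n → ℂ}
    (hν : ∀ i, ⁅(Matrix.single i i 1 : GLie n), incl L P⁆ = ν i • incl L P) :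
    GLie.IsWeightModule n (MultiplicitySpace L P) := by
  refine jointlyDiagonalizable_of_iSup_eq_top ?_
  set T : Fin n → Module.End ℂ (MultiplicitySpace L P) :=
    fun i => LieModule.toEnd ℂ (GLie n) _ (Matrix.single i i 1) with hT
  set U := ⨆ α, jointEigenspace T α with hU
  have hsingle : ∀ k l, ∀ f ∈ U, ⁅(Matrix.single k l 1 : GLie n), f⁆ ∈ U := by
    intro k l
    change U ≤ U.comap (LieModule.toEnd ℂ (GLie n) _ (Matrix.single k l 1))
    refine iSup_le fun α f hf => ?_
    rw [mem_jointEigenspace] at hf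
    refine Submodule.mem_iSup_of_mem
      (fun i => α i + ((if i = k then 1 else 0) - (if i = l then 1 else 0))) ?_
    rw [mem_jointEigenspace]
    intro i
    have hfi : ⁅(Matrix.single i i 1 : GLie n), f⁆ = α i • f := hf i
    change ⁅(Matrix.single i i 1 : GLie n), ⁅(Matrix.single k l 1 : GLie n), f⁆⁆
      = _ • ⁅(Matrix.single k l 1 : GLie n), f⁆
    have h1 : ⁅(Matrix.single i i 1 : GLie n), (Matrix.single k l 1 : GLie n)⁆
        = ((if i = k then 1 else 0) - (if i = l then 1 else 0) : ℂ) • Matrix.single k l 1 := by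
      rw [LieRing.of_associative_ring_bracket, sub_smul]
      congr 1
      · split_ifs with h
        · subst h; simp
        · rw [Matrix.single_mul_single_of_ne _ _ _ _ h, zero_smul]
      · split_ifs with h
        · subst h; simp
        · rw [Matrix.single_mul_single_of_ne _ _ _ _ (Ne.symm h), zero_smul]
    rw [leibniz_lie, h1, hfi, smul_lie, lie_smul, ← add_smul, add_comm]
  let N : LieSubmodule ℂ (GLie n) (MultiplicitySpace L P) :=
    { U with
      lie_mem := by
        intro a f hf
        rw [Matrix.matrix_eq_sum_single a, sum_lie]
        refine U.sum_mem fun i _ => ?_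
        rw [sum_lie]
        refine U.sum_mem fun j _ => ?_
        rw [GLie.single_eq_smul, smul_lie]
        exact U.smul_mem _ (hsingle i j f hf) }
  have hN : N.toSubmodule = U := rfl
  have hmem : incl L P ∈ N :=
    Submodule.mem_iSup_of_mem (p := jointEigenspace T) ν (mem_jointEigenspace.mpr hν)
  rcases eq_bot_or_eq_top N with h | h
  · rw [h] at hmem
    exact absurd ((LieSubmodule.mem_bot _).mp hmem) incl_ne_zero
  · rw [← hN, h]; simp

end MultiplicitySpace

end Multiplicity

/-! ### The decomposition of a simple `AW_n⁺` module -/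

section Decomposition

open MvPolynomial

variable {n : ℕ} {V : Type*} [AddCommGroup V] [Module ℂ V]

/-- The action of the Weyl algebra defined by the action of the polynomials and of the vector
fields `∂_j`. -/
noncomputable def WittPlus.IsFieldAction.weylHom {R : Type*} [Ring R] [Algebra ℂ R]
    {A : MvPolynomial (Fin n) ℂ →ₐ[ℂ] R} {Φ : Fin n → MvPolynomial (Fin n) ℂ →ₗ[ℂ] R}
    (h : WittPlus.IsFieldAction A Φ) : WeylAlgebra n →ₐ[ℂ] R :=
  RingQuot.liftAlgHom ℂ (s := WeylAlgebra.Rel n)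
    ⟨FreeAlgebra.lift ℂ (Sum.elim (fun i => A (X i)) fun i => Φ i 1), by
      intro x y hxy
      induction hxy with
      | t_comm i j =>
        simp only [map_mul, FreeAlgebra.lift_ι_apply, Sum.elim_inl]
        rw [← map_mul, mul_comm, map_mul]
      | d_comm i j =>
        simp only [map_mul, FreeAlgebra.lift_ι_apply, Sum.elim_inr]
        have := h.comm_field i j 1 1
        rw [(pderiv i).map_one_eq_zero, (pderiv j).map_one_eq_zero, mul_zero, map_zero, map_zero,
          sub_zero] at this
        exact sub_eq_zero.mp this
      | d_t i j =>
        simp only [map_mul, map_add, FreeAlgebra.lift_ι_apply, Sum.elim_inl, Sum.elim_inr]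
        rw [h.comm_poly', one_mul, pderiv_X, Pi.single_apply]
        congr 1
        simp only [eq_comm (a := j)]
        split_ifs <;> simp⟩

section weylHom

variable {R : Type*} [Ring R] [Algebra ℂ R]
    {A : MvPolynomial (Fin n) ℂ →ₐ[ℂ] R} {Φ : Fin n → MvPolynomial (Fin n) ℂ →ₗ[ℂ] R}
    (h : WittPlus.IsFieldAction A Φ)

theorem WittPlus.IsFieldAction.weylHom_t (i : Fin n) : h.weylHom (WeylAlgebra.t i) = A (X i) :=
  (RingQuot.liftAlgHom_mkAlgHom_apply ..).trans (FreeAlgebra.lift_ι_apply _ _)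

theorem WittPlus.IsFieldAction.weylHom_d (i : Fin n) : h.weylHom (WeylAlgebra.d i) = Φ i 1 :=
  (RingQuot.liftAlgHom_mkAlgHom_apply ..).trans (FreeAlgebra.lift_ι_apply _ _)

theorem WittPlus.IsFieldAction.weylHom_ofPoly (f : MvPolynomial (Fin n) ℂ) :
    h.weylHom (WeylAlgebra.ofPoly n f) = A f := by
  have : h.weylHom.comp (WeylAlgebra.ofPoly n) = A := by
    apply MvPolynomial.algHom_ext
    intro i
    rw [AlgHom.comp_apply, WeylAlgebra.ofPoly_X, h.weylHom_t]
  exact DFunLike.congr_fun this f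

theorem WittPlus.IsFieldAction.matrixUnit_comm_weylHom (i j : Fin n) (a : WeylAlgebra n) :
    Commute (WittPlus.matrixUnit A Φ i j) (h.weylHom a) := by
  have ha : a ∈ Algebra.adjoin ℂ
      (Set.range (WeylAlgebra.t : Fin n → WeylAlgebra n) ∪ Set.range WeylAlgebra.d) := by
    rw [WeylAlgebra.adjoin_generators]; exact Algebra.mem_top
  induction ha using Algebra.adjoin_induction with
  | mem x hx =>
    rcases hx with ⟨k, rfl⟩ | ⟨k, rfl⟩
    · rw [h.weylHom_t]; exact h.matrixUnit_comm_poly i j _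
    · rw [h.weylHom_d]; exact h.matrixUnit_comm_d i j k
  | algebraMap c => rw [AlgHom.commutes]; exact (Algebra.commutes c _).symm
  | add x y _ _ hx hy => rw [map_add]; exact hx.add_right hy
  | mul x y _ _ hx hy => rw [map_mul]; exact hx.mul_right hy

end weylHom

variable [Module (WeylAlgebra n) V] [IsScalarTower ℂ (WeylAlgebra n) V]
  [LieRingModule (WittPlus.Ext n) V] [LieModule ℂ (WittPlus.Ext n) V]

/-- If the vector fields act on `V` as on a tensor module, with `gl_n` acting through `L`, then
evaluation commutes with the action of `W̃_n⁺`. -/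
theorem MultiplicitySpace.eval_lie {L : GLie n →ₗ⁅ℂ⁆ Module.End (WeylAlgebra n) V}
    {P : Submodule (WeylAlgebra n) V}
    (hpoly : ∀ f (w : V), ⁅WittPlus.Ext.poly f, w⁆ = WeylAlgebra.ofPoly n f • w)
    (hfield : ∀ (j : Fin n) f (w : V), ⁅WittPlus.Ext.field (f • (pderiv j : WittPlus n)), w⁆
      = (WeylAlgebra.ofPoly n f * WeylAlgebra.d j) • w
        + ∑ i, WeylAlgebra.ofPoly n (pderiv i f) • L (Matrix.single i j 1) w)
    (x : WittPlus.Ext n) (w : P ⊗[ℂ] MultiplicitySpace L P) :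
    eval L P (TensorModule.act n P (MultiplicitySpace L P) x w) = ⁅x, eval L P w⁆ := by
  induction w using TensorProduct.induction_on with
  | zero => rw [map_zero, map_zero, lie_zero]
  | add u v hu hv => rw [map_add, map_add, hu, hv, map_add, lie_add]
  | tmul p f =>
    have h1 : TensorModule.act n P (MultiplicitySpace L P) x (p ⊗ₜ f)
        = (WeylAlgebra.ofPoly n x.left • p) ⊗ₜ f
          + ∑ j, TensorModule.monoAct n P _ j (x.right (X j)) (p ⊗ₜ f) := by
      change (TensorModule.weylAct n P (MultiplicitySpace L P) (WeylAlgebra.ofPoly n x.left)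
        + ∑ j, TensorModule.monoAct n P (MultiplicitySpace L P) j (x.right (X j))) (p ⊗ₜ f) = _
      rw [LinearMap.add_apply, LinearMap.sum_apply, TensorModule.weylAct_tmul]
    conv_rhs => rw [WittPlus.Ext.eq_poly_add_sum x]
    rw [h1, map_add, map_sum, eval_tmul, eval_tmul, add_lie, sum_lie, hpoly, map_smul]
    congr 1
    refine Finset.sum_congr rfl fun j _ => ?_
    rw [hfield, TensorModule.monoAct_tmul, map_add, map_sum, eval_tmul, map_smul]
    congr 1
    refine Finset.sum_congr rfl fun i _ => ?_
    rw [eval_tmul, lie_apply, map_smul, map_smul]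

end Decomposition

theorem theorem3p7 (n : ℕ) (hn : 0 < n) (V : Type u) [AddCommGroup V] [Module ℂ V]
    [LieRingModule (WittPlus.Ext n) V] [LieModule ℂ (WittPlus.Ext n) V]
    (hAW : IsAWModule n V)
    (hsimple : LieModule.IsIrreducible ℂ (WittPlus.Ext n) V)
    (hweight : WittPlus.IsWeightModule n V)
    (hfin : ∃ lam : Fin n → ℂ, WittPlus.weightSpace V lam ≠ ⊥ ∧
      FiniteDimensional ℂ (WittPlus.weightSpace V lam)) :
    ∃ (P : Type u) (_ : AddCommGroup P) (_ : Module ℂ P) (_ : Module (WeylAlgebra n) P)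
      (_ : IsScalarTower ℂ (WeylAlgebra n) P)
      (M : Type u) (_ : AddCommGroup M) (_ : Module ℂ M) (_ : LieRingModule (GLie n) M)
      (_ : LieModule ℂ (GLie n) M),
      IsSimpleModule (WeylAlgebra n) P ∧ WeylAlgebra.IsWeightModule n P ∧
      LieModule.IsIrreducible ℂ (GLie n) M ∧ GLie.IsWeightModule n M ∧
      Nonempty (V ≃ₗ⁅ℂ, WittPlus.Ext n⁆ TensorModule n P M) := by
  have h := WittPlus.isFieldAction hAW
  let _ : Module (WeylAlgebra n) V := Module.compHom V h.weylHom.toRingHom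
  have hsmul : ∀ (a : WeylAlgebra n) (w : V), a • w = h.weylHom a w := fun _ _ => rfl
  have : IsScalarTower ℂ (WeylAlgebra n) V := ⟨fun c a w => by
    rw [hsmul, hsmul, map_smul, LinearMap.smul_apply]⟩
  let e : Fin n → Fin n → Module.End (WeylAlgebra n) V := fun i j =>
    { WittPlus.matrixUnit (WittPlus.polyAct hAW) (WittPlus.fieldAct V) i j with
      map_smul' := fun a w => DFunLike.congr_fun (h.matrixUnit_comm_weylHom i j a).eq w }
  have he_apply : ∀ i j w,
      e i j w = WittPlus.matrixUnit (WittPlus.polyAct hAW) (WittPlus.fieldAct V) i j w :=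
    fun _ _ _ => rfl
  have he : ∀ i j k l, e i j * e k l - e k l * e i j
      = (if j = k then e i l else 0) - (if l = i then e k j else 0) := by
    intro i j k l
    ext w
    have h1 := DFunLike.congr_fun (h.matrixUnit_mul_matrixUnit i j k l) w
    refine Eq.trans h1 ?_
    split_ifs <;> rfl
  let L : GLie n →ₗ⁅ℂ⁆ Module.End (WeylAlgebra n) V := GLie.homOfMatrixUnits e he
  have hL : ∀ i j, L (Matrix.single i j 1) = e i j := GLie.homOfMatrixUnits_single e he
  -- The central element of `gl_n` acts by a scalar, which determines the action of vector fields.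
  obtain ⟨lam, hne, hfd⟩ := hfin
  obtain ⟨v, hv, μ, ν, hμ, hν⟩ := WittPlus.exists_joint_eigenvector_of_weightSpace hAW hne hfd
  have hE : ∀ w, (∑ i, WittPlus.matrixUnit (WittPlus.polyAct hAW) (WittPlus.fieldAct V) i i) w
      = (∑ i, ν i) • w :=
    WittPlus.sum_matrixUnit_apply_eq_smul hAW hsimple hv (by
      rw [LinearMap.sum_apply, Finset.sum_smul]
      exact Finset.sum_congr rfl fun i _ => hν i)
  have hfield : ∀ (j : Fin n) f (w : V),
      ⁅WittPlus.Ext.field (f • (MvPolynomial.pderiv j : WittPlus n)), w⁆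
      = (WeylAlgebra.ofPoly n f * WeylAlgebra.d j) • w
        + ∑ i, WeylAlgebra.ofPoly n (MvPolynomial.pderiv i f) • L (Matrix.single i j 1) w := by
    intro j f w
    have h1 := DFunLike.congr_fun (h.field_eq_of_commute (fun j g => LinearMap.ext fun w => by
      rw [Module.End.mul_apply, Module.End.mul_apply, hE, hE, map_smul]) j f) w
    rw [← WittPlus.fieldAct_apply, h1, LinearMap.add_apply, LinearMap.sum_apply, hsmul, map_mul,
      h.weylHom_ofPoly, h.weylHom_d]
    congr 1
    refine Finset.sum_congr rfl fun i _ => ?_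
    rw [hsmul, h.weylHom_ofPoly, hL, he_apply]
    rfl
  have hpoly : ∀ f (w : V), ⁅WittPlus.Ext.poly f, w⁆ = WeylAlgebra.ofPoly n f • w := by
    intro f w
    rw [hsmul, h.weylHom_ofPoly]
    rfl
  -- Simplicity of `V` under the commuting actions of the Weyl algebra and of `gl_n`.
  have hs' : ∀ N : Submodule (WeylAlgebra n) V, (∀ k : Fin n × Fin n, ∀ w ∈ N, e k.1 k.2 w ∈ N) →
      N = ⊥ ∨ N = ⊤ := by
    intro N hN
    have h1 := WittPlus.eq_bot_or_eq_top_of_stable hAW hsimple (N.restrictScalars ℂ)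
      (fun f w hw => by
        rw [WittPlus.polyAct_apply, hpoly]
        exact N.smul_mem _ hw)
      (fun j f w hw => by
        rw [WittPlus.fieldAct_apply, hfield]
        refine N.add_mem (N.smul_mem _ hw) (N.sum_mem fun i _ => N.smul_mem _ ?_)
        rw [hL]
        exact hN (i, j) w hw)
    rwa [Submodule.restrictScalars_eq_bot_iff, Submodule.restrictScalars_eq_top_iff] at h1
  have hs : ∀ N : Submodule (WeylAlgebra n) V, (∀ a, ∀ w ∈ N, L a w ∈ N) → N = ⊥ ∨ N = ⊤ :=
    fun N hN => hs' N fun k w hw => hL k.1 k.2 ▸ hN _ w hw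
  have hreg : WeylAlgebra.IsRegular n V := WeylAlgebra.isRegular_of_simple _ hs'
  have hwv : WeylAlgebra.IsWeightVector n μ v := fun i => by
    rw [hsmul, map_mul, h.weylHom_t, h.weylHom_d]
    exact hμ i
  let P := Submodule.span (WeylAlgebra n) {v}
  have hP : IsSimpleModule (WeylAlgebra n) P := hreg.isSimpleModule_span hv hwv
  have : Nontrivial P := IsSimpleModule.nontrivial (WeylAlgebra n) P
  obtain ⟨ι, b, χ, hχ, hb⟩ := WeylAlgebra.exists_basis_span hwv
  have hinj : Function.Injective (MultiplicitySpace.eval L P) :=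
    MultiplicitySpace.eval_injective b hχ hb
  have hirr := MultiplicitySpace.isIrreducible hinj hs
  have hνP : ∀ i, ⁅(Matrix.single i i 1 : GLie n), MultiplicitySpace.incl L P⁆
      = ν i • MultiplicitySpace.incl L P := by
    intro i
    ext ⟨p, hp⟩
    obtain ⟨a, rfl⟩ := Submodule.mem_span_singleton.mp hp
    rw [MultiplicitySpace.lie_apply, MultiplicitySpace.smul_apply, MultiplicitySpace.incl_apply, hL,
      map_smul, he_apply, hν, smul_comm]
  let φ : P ⊗[ℂ] MultiplicitySpace L P ≃ₗ[ℂ] V :=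
    LinearEquiv.ofBijective (MultiplicitySpace.eval L P)
      ⟨hinj, MultiplicitySpace.eval_surjective hs⟩
  let ψ : TensorModule n P (MultiplicitySpace L P) ≃ₗ⁅ℂ, WittPlus.Ext n⁆ V :=
    { φ with
      map_lie' := fun {x w} => MultiplicitySpace.eval_lie hpoly hfield x w }
  exact ⟨P, inferInstance, inferInstance, inferInstance, inferInstance, MultiplicitySpace L P,
    inferInstance, inferInstance, inferInstance, inferInstance, hP,
    WeylAlgebra.isWeightModule_span hwv, hirr, MultiplicitySpace.isWeightModule hirr hνP,
    ⟨ψ.symm⟩⟩
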